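/- **Setting.** A CSS code of block size $n$ (with at least one logical qubit) has a number $t$ of errors that it corrects with certainty: the largest $t$ such that any two $X$-error patterns of weight at most $t$ with the same syndrome differ by a stabilizer, and likewise for $Z$-error patterns. Take a sequence of CSS codes with $n\to\infty$ and $t/n\to\tau$, the asymptotic correctable fraction. A *homogeneous procedure* is a finite list of operations on blocks, each applied identically to all $n$ qubits: loading an encoded ancilla of type $A$ or $B$, the gates $H$, $P$ and $CX$, measurement in the computational basis, relabelling of blocks, and updates of the record of known $X$ or $Z$ errors (instead of recovery gates). Operations fail independently by Pauli errors: a one-qubit gate is followed by $\Gamma\in\{X,Y,Z\}$ with probability $p_\Gamma$; a $CX$ by $\Lambda\Xi\ne II$ ($\Lambda$ on the control, $\Xi$ on the target) with probability $p_{\Lambda\Xi}$; a measurement result is flipped with probability $p_M$; ancilla qubits have independent, identically distributed errors, $\Gamma$ with probability $a_\Gamma$ (type $A$) or $b_\Gamma$ (type $B$). There are no memory errors. Errors propagate through the (Clifford) operations; the procedure thus splits into $n$ independent, identically distributed copies of its *strand* (the same circuit on single qubits). For a measurement step $\mathcal L$ let $p_{\mathcal L}$ be the probability that, on one strand, the result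 is flipped by an error that is not yet known. The step *fails* if more than $t$ of the $n$ results are flipped; the locations of the flips are treated as revealed and may determine later updates of the record, strand by strand. Let $s$ be the sum of all the error rates above. **Procedures.** $F_X$ on a data block: couple it by $CX$ (data as control) to an $A$-ancilla, measure the ancilla, and record an $X$ error on the qubits whose result is flipped. $F_Z$: couple a $B$-ancilla (as control) to the data by $CX$, apply $H$ to the ancilla and measure it, and record $Z$ errors in the same way. $F_X',F_Z'$: couple twice to fresh ancillae and record an error exactly on the qubits flipped both times. *Single-coupling Steane*, in order of time: idle $F_ZF_X\,|\,F_XF_Z\,F_ZF_X$; $H$: $F_ZF_X\,|\,H\,F_XF_Z$; $CX$: control $F_ZF_X\,|\,CX\,F_ZF_X$, target $F_XF_Z\,|\,CX\,F_XF_Z$; $P,T$: data $F_XF_Z\,|\,$, then $CX$ from a $B$-ancilla to the data, measurement of the data, and $F_Z$ on the ancilla, which becomes the data. *Double-coupling Steane*: the same with $F'$ for $F$, and for $P,T$ an additional final $F_X$. Here $|$ marks the end of the initial error correction. *Knill*: $K_A$: $CX$ from the data to an $A$-ancilla, $H$ on the data, measure both; $K_B$: $CX$ from a $B$-ancilla to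 the data, measure the data, $H$ on the ancilla and measure it; the output of either is the surviving half of the teleportation ancilla, with independent $A$- or $B$-type errors as the next gate needs. Idle, $P$, $T$: $B$-type input, $K_A$; $H$: $B$-type input, $H$, $K_B$; $CX$: $B$-type control and $A$-type target, $CX$, then $K_A$ on the control and $K_B$ on the target. An *encoded computation* is any finite sequence of preparations (by $B$-ancillae), idle steps and gates $H$, $CX$, $P,T$ on any number of logical qubits. In Steane's procedures the error correction that ends one step is the initial one of the next; each step must find its inputs corrected in the order with which its circuit begins; the idle step, cut into its two halves, is used to switch the order; a preparation is followed by $F_ZF_X$, and $P,T$ ends with $F_ZF_X$ (with $F'$ for double coupling). Computation *can continue indefinitely* if there is $c>0$ such that, for all sufficiently late codes of the sequence, every encoded computation with $N$ measurement steps has probability at most $Ne^{-cn}$ that any of its steps fails. **Table** of the first-order expressions $T_{m,g}$ of procedure $m$ and encoded gate $g$: Single-coupling Steane: - idle: $\max\{4(p_{YI}+p_{YX}+p_{ZI}+p_{ZX})+3(p_{YY}+p_{YZ}+p_{ZY}+p_{ZZ})+2(p_X+p_Y+p_M+a_Y+a_Z+b_Y+b_Z)+p_{IY}+p_{IZ}+p_{XY}+p_{XZ},\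 \ 4(p_{IX}+p_{IY}+p_{ZX}+p_{ZY})+3(p_{XX}+p_{XY}+p_{YX}+p_{YY})+2(p_M+a_X+a_Y+b_X+b_Y)+p_{XI}+p_{XZ}+p_{YI}+p_{YZ}\}$ - $H$: $\max\{3(p_{YX}+p_{ZX})+2(p_X+p_Y+p_M+p_{IY}+p_{XY}+p_{YI}+p_{YY}+p_{ZI}+p_{ZY}+a_Y)+p_{IX}+p_{IZ}+p_{XX}+p_{XZ}+p_{YZ}+p_{ZZ}+a_X+a_Z+b_Y+b_Z,\ \ 3(p_{YI}+p_{YZ}+p_{ZX}+p_{ZY})+2(p_Y+p_M+p_{YX}+p_{YY}+p_{ZI}+p_{ZZ}+a_Y)+p_X+p_Z+p_{IX}+p_{IY}+p_{XI}+p_{XZ}+a_X+a_Z+b_Y+b_Z\}$ - $CX$: $\max\{5(p_{YI}+p_{YX}+p_{ZI}+p_{ZX})+3(p_X+p_Y+p_M+p_{YY}+p_{YZ}+p_{ZY}+p_{ZZ}+b_Y+b_Z)+2(p_{IY}+p_{IZ}+p_{XY}+p_{XZ})+a_Y+a_Z,\ \ 5(p_{IX}+p_{IY}+p_{ZX}+p_{ZY})+3(p_M+p_{XX}+p_{XY}+p_{YX}+p_{YY}+a_X+a_Y)+2(p_{XI}+p_{XZ}+p_{YI}+p_{YZ})+b_X+b_Y\}$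 - $P,T$: $\max\{3(p_{IX}+p_{IY}+p_{ZX}+p_{ZY})+2(p_M+p_{XX}+p_{XY}+p_{YX}+p_{YY}+b_X+b_Y)+p_{XI}+p_{XZ}+p_{YI}+p_{YZ}+a_X+a_Y,\ \ 3(p_{YI}+p_{YX}+p_{ZI}+p_{ZX}+b_Y+b_Z)+2(p_X+p_Y+p_M+p_{YY}+p_{YZ}+p_{ZY}+p_{ZZ})+p_{IY}+p_{IZ}+p_{XY}+p_{XZ}\}$ Double-coupling Steane: - idle: $\max\{7(p_{YY}+p_{YZ}+p_{ZY}+p_{ZZ})+5(p_{YI}+p_{YX}+p_{ZI}+p_{ZX})+4(a_Y+a_Z)+3(p_{IY}+p_{IZ}+p_{XY}+p_{XZ})+p_X+p_Y+p_M+b_Y+b_Z,\ \ 7(p_{XX}+p_{XY}+p_{YX}+p_{YY})+5(p_{IX}+p_{IY}+p_{ZX}+p_{ZY})+4(b_X+b_Y)+3(p_{XI}+p_{XZ}+p_{YI}+p_{YZ})+p_M+a_X+a_Y\}$ - $H$: $\max\{5p_{YY}+4(p_{XY}+p_{YX}+p_{YZ}+p_{ZY})+3(p_{IY}+p_{XZ}+p_{YI}+p_{ZX}+p_{ZZ}+a_Y)+2(p_{IZ}+p_{XX}+p_{ZI}+a_Z)+p_X+p_Y+p_M+p_{IX}+p_{XI}+a_X,\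 \ 6p_{YZ}+5(p_{YI}+p_{YY})+4(p_{YX}+p_{ZY}+p_{ZZ})+3(p_{XZ}+p_{ZI}+p_{ZX})+2(p_Y+p_{XI}+p_{XY}+a_Y+a_Z)+p_X+p_Z+p_M+p_{IY}+p_{IZ}+p_{XX}+b_Y+b_Z\}$ - $CX$: $\max\{7(p_{YY}+p_{YZ}+p_{ZY}+p_{ZZ})+5(p_{IY}+p_{IZ}+p_{XY}+p_{XZ})+4(p_{YI}+p_{YX}+p_{ZI}+p_{ZX})+2(a_Y+a_Z)+p_X+p_Y+p_M+b_Y+b_Z,\ \ 7(p_{XX}+p_{XY}+p_{YX}+p_{YY})+5(p_{XI}+p_{XZ}+p_{YI}+p_{YZ})+4(p_{IX}+p_{IY}+p_{ZX}+p_{ZY})+2(b_X+b_Y)+p_M+a_X+a_Y\}$ - $P,T$: $\max\{4(p_{XX}+p_{XY}+p_{YX}+p_{YY})+3(p_{IX}+p_{IY}+p_{ZX}+p_{ZY}+b_X+b_Y)+2(p_{XI}+p_{XZ}+p_{YI}+p_{YZ})+p_M,\ \ 4(p_{YY}+p_{YZ}+p_{ZY}+p_{ZZ})+3(p_{IY}+p_{IZ}+p_{XY}+p_{XZ})+2(p_{YI}+p_{YX}+p_{ZI}+p_{ZX}+b_Y+b_Z)+p_X+p_Y+p_M,\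 \ 4(p_{XX}+p_{XY}+p_{YX}+p_{YY})+3(p_{IX}+p_{IY}+p_{ZX}+p_{ZY}+b_X+b_Y)+p_M+p_{XI}+p_{XZ}+p_{YI}+p_{YZ}+a_X+a_Y\}$ Knill: - idle, $P,T$: $\max\{p_X+p_Y+p_M+p_{YI}+p_{YX}+p_{YY}+p_{YZ}+p_{ZI}+p_{ZX}+p_{ZY}+p_{ZZ}+a_Y+a_Z+b_Y+b_Z,\ \ p_M+p_{IX}+p_{IY}+p_{XX}+p_{XY}+p_{YX}+p_{YY}+p_{ZX}+p_{ZY}+a_X+a_Y+b_X+b_Y\}$ - $H$: $\max\{2b_Y+p_X+p_Y+p_M+p_{IX}+p_{IY}+p_{XX}+p_{XY}+p_{YX}+p_{YY}+p_{ZX}+p_{ZY}+b_X+b_Z,\ \ 2(p_Y+b_Y)+p_X+p_Z+p_M+p_{YI}+p_{YX}+p_{YY}+p_{YZ}+p_{ZI}+p_{ZX}+p_{ZY}+p_{ZZ}+b_X+b_Z\}$ - $CX$: $\max\{2(p_{YI}+p_{YX}+p_{YY}+p_{YZ}+p_{ZI}+p_{ZX}+p_{ZY}+p_{ZZ}+a_Y+a_Z)+p_X+p_Y+p_M+b_Y+b_Z,\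 \ 2(p_{XX}+p_{XY}+p_{YX}+p_{YY})+p_M+p_{IX}+p_{IY}+p_{XI}+p_{XZ}+p_{YI}+p_{YZ}+p_{ZX}+p_{ZY}+a_X+a_Y+b_X+b_Y,\ \ 2(p_{IX}+p_{IY}+p_{XX}+p_{XY}+p_{YX}+p_{YY}+p_{ZX}+p_{ZY}+b_X+b_Y)+p_M+a_X+a_Y,\ \ 2(p_{YY}+p_{YZ}+p_{ZY}+p_{ZZ})+p_X+p_Y+p_M+p_{IY}+p_{IZ}+p_{XY}+p_{XZ}+p_{YI}+p_{YX}+p_{ZI}+p_{ZX}+a_Y+a_Z+b_Y+b_Z\}$ Let $T_m=\max_g T_{m,g}$. **Theorem.** 1. For every homogeneous procedure and measurement step, $\Pr[\mathcal L\text{ fails}]=\sum_{i=t+1}^n\binom ni p_{\mathcal L}^i(1-p_{\mathcal L})^{n-i}$. As $n\to\infty$ with $t/n\to\tau$ it tends to $0$ if $p_{\mathcal L}<\tau$ and to $1$ if $p_{\mathcal L}>\tau$; in the second case the probability that some step of the procedure fails also tends to $1$. 2. For every $q<\tau$ there is $c>0$ such that, for all sufficiently late codes, all error rates and all homogeneous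 procedures with $N$ measurement steps for which $p_{\mathcal L}\le q$ at every measurement step, the probability that any step fails is at most $Ne^{-cn}$. 3. There is an absolute constant $A$ such that, for each of the three procedures, each encoded gate and all error rates, the maximum of $p_{\mathcal L}$ over the measurement steps after the initial error correction of the gate's circuit differs from $T_{m,g}$ by at most $As^2$. 4. There are absolute constants $B_m\ge0$, with $B_m=0$ for single-coupling Steane and for Knill, such that $p_{\mathcal L}\le T_m+B_ms^2$ at every measurement step of every encoded computation. Consequently, if $T_m+B_ms^2<\tau$, computation can continue indefinitely. 5. Consider the error models with one parameter $p$ (unspecified rates are zero): #1 (depolarizing): $p_\Gamma=\frac p4$, $p_{\Lambda\Xi}=\frac p{16}$, $p_M=\frac p2$, $a_X=b_Z=\frac p4$, $a_Y=a_Z=b_X=b_Y=\frac p8$; #2: $p_\Gamma=\frac{4p}{15}$, $p_{\Lambda\Xi}=\frac p{15}$, $p_M=4p$, $a_X=b_Z=\frac{4p}{15}$, $a_Y=a_Z=b_X=b_Y=\frac{2p}{15}$; #3: $p_{\Lambda\Xi}$ and the ancilla rates as in #2; #4: $p_{IX}=p_{XI}=p_{IZ}=p_{ZI}=\frac p4$,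 $a_X=b_Z=\frac p2$, $a_Z=b_X=\frac p4$. For $p\ge0$ the first-order criterion $T_m\le\tau$ holds exactly if $p\le\kappa\tau$, where $\kappa$ for models #1, #2, #3, #4 is $\frac8{55},\frac{15}{266},\frac{15}{62},\frac27$ for single-coupling Steane, $\frac8{49},\frac1{10},\frac{15}{82},\frac27$ for double-coupling Steane, and $\frac8{23},\frac{15}{98},\frac12,\frac23$ for Knill; rounded to two decimals these are $0.15,0.06,0.24,0.29$; $0.16,0.10,0.18,0.29$; and $0.35,0.15,0.50,0.67$. 6. For single-coupling Steane and for Knill these thresholds are rigorous: if $p<\kappa\tau$ (and the rates of the model are probabilities), computation can continue indefinitely. In particular this holds for Knill's procedure under depolarizing noise (#1) for $p<\frac8{23}\tau\approx0.35\,\tau$. -/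

import Mathlib

open Filter Topology

noncomputable section

namespace Homogeneous

/-! ## CSS codes and the number of errors they correct with certainty -/

/-- A CSS code on `n` qubits encoding at least one logical qubit.  `SX` and `SZ` are the binary
spaces of the supports of the `X`-type and of the `Z`-type stabilizer elements; `orth` says that
the two kinds of stabilizers commute. -/
structure CSSCode (n : ℕ) where
  SX : Submodule (ZMod 2) (Fin n → ZMod 2)
  SZ : Submodule (ZMod 2) (Fin n → ZMod 2)
  orth : ∀ u ∈ SX, ∀ v ∈ SZ, u ⬝ᵥ v = 0
  logical : Module.finrank (ZMod 2) SX + Module.finrank (ZMod 2) SZ < n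

/-- Error patterns of weight at most `t` are corrected with certainty if any two of them that have
the same syndrome with respect to the checks `S` differ by an element of the group `G` of harmless
(stabilizer) patterns. -/
def CorrectsWeight {n : ℕ} (S G : Submodule (ZMod 2) (Fin n → ZMod 2)) (t : ℕ) : Prop :=
  ∀ e e' : Fin n → ZMod 2, hammingNorm e ≤ t → hammingNorm e' ≤ t →
    (∀ v ∈ S, v ⬝ᵥ e = v ⬝ᵥ e') → e - e' ∈ G

/-- The code corrects all `X`-error patterns and all `Z`-error patterns of weight at most `t`. -/
def CSSCode.Corrects {n : ℕ} (C : CSSCode n) (t : ℕ) : Prop :=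
  CorrectsWeight C.SZ C.SX t ∧ CorrectsWeight C.SX C.SZ t

/-- The maximal number of errors that the code corrects with certainty. -/
def CSSCode.correctable {n : ℕ} (C : CSSCode n) : ℕ :=
  sSup {t : ℕ | t ≤ n ∧ C.Corrects t}

/-- A sequence of CSS codes whose block size tends to infinity. -/
structure CodeFamily where
  len : ℕ → ℕ
  code : ∀ k, CSSCode (len k)
  unbounded : Tendsto len atTop atTop

/-- `t` of the `k`-th code of the family. -/
def CodeFamily.t (F : CodeFamily) (k : ℕ) : ℕ := (F.code k).correctable

/-- `τ` is the asymptotic correctable fraction `lim t / n` of the family. -/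
def CodeFamily.HasFraction (F : CodeFamily) (τ : ℝ) : Prop :=
  Tendsto (fun k => (F.t k : ℝ) / (F.len k : ℝ)) atTop (𝓝 τ)

/-! ## Pauli errors and the stochastic error model -/

inductive Pauli where
  | I | X | Y | Z
  deriving DecidableEq

instance : Fintype Pauli := ⟨{.I, .X, .Y, .Z}, by intro P; cases P <;> decide⟩

/-- Does the Pauli operator contain a bit flip? -/
def Pauli.xbit : Pauli → Bool
  | .I => false | .X => true | .Y => true | .Z => false

/-- Does the Pauli operator contain a phase flip? -/
def Pauli.zbit : Pauli → Bool
  | .I => false | .X => false | .Y => true | .Z => true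

/-- The two kinds of ancillae: in places where `Z` errors (`A`), respectively `X` errors (`B`), are
the more disruptive ones. -/
inductive Anc where
  | A | B
  deriving DecidableEq

open Pauli Anc

/-- The error rates of the unencoded operations: `one Γ` for single-qubit gates, `two Λ Ξ` for the
controlled-NOT gate (`Λ` on the control, `Ξ` on the target), `meas` for measurements and `anc a Γ`
for each qubit of an ancilla of type `a`.  Values at the identity are ignored: the probability of
no error is what remains. -/
structure Rates where
  one : Pauli → ℝ
  two : Pauli → Pauli → ℝ
  meas : ℝ
  anc : Anc → Pauli → ℝ

/-- Total error probability of a single-qubit error distribution. -/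
def sum1 (f : Pauli → ℝ) : ℝ := f X + f Y + f Z

/-- Total error probability of a two-qubit error distribution. -/
def sum2 (f : Pauli → Pauli → ℝ) : ℝ :=
  ∑ P : Pauli, ∑ Q : Pauli, if P = I ∧ Q = I then 0 else f P Q

/-- The rates are probabilities. -/
structure Rates.Valid (r : Rates) : Prop where
  one_nonneg : ∀ P, P ≠ I → 0 ≤ r.one P
  one_le : sum1 r.one ≤ 1
  two_nonneg : ∀ P Q, ¬ (P = I ∧ Q = I) → 0 ≤ r.two P Q
  two_le : sum2 r.two ≤ 1
  meas_nonneg : 0 ≤ r.meas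
  meas_le : r.meas ≤ 1
  anc_nonneg : ∀ a P, P ≠ I → 0 ≤ r.anc a P
  anc_le : ∀ a, sum1 (r.anc a) ≤ 1

/-- Sum of all error rates of the model. -/
def Rates.total (r : Rates) : ℝ :=
  sum1 r.one + sum2 r.two + r.meas + sum1 (r.anc A) + sum1 (r.anc B)

/-- Probability of the single-qubit Pauli error `P`, the identity included. -/
def weight1 (f : Pauli → ℝ) (P : Pauli) : ℝ := if P = I then 1 - sum1 f else f P

/-- Probability of the two-qubit Pauli error `P ⊗ Q`, the identity included. -/
def weight2 (f : Pauli → Pauli → ℝ) (P Q : Pauli) : ℝ :=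
  if P = I ∧ Q = I then 1 - sum2 f else f P Q

/-! ## Homogeneous procedures

A homogeneous procedure applies every operation in the same way to all qubits of the encoded blocks
it acts on.  It is described by the list of its operations on blocks (labelled by natural numbers);
the same list, read as a list of operations on single qubits, is its strand. -/

inductive Instr where
  /-- load a fresh encoded ancilla of the given type into a block -/
  | prep (b : ℕ) (a : Anc)
  /-- Hadamard gate -/
  | had (b : ℕ)
  /-- phase gate (or its inverse) -/
  | phase (b : ℕ)
  /-- controlled-NOT gate -/
  | cx (c t : ℕ)
  /-- measurement of every qubit of the block in the computational basis -/
  | meas (b : ℕ)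
  /-- update of the record of known `X` errors of a block: the located measurement errors of a
  strand (most recent first) determine whether its qubit is declared to carry an `X` error -/
  | fixX (b : ℕ) (f : List Bool → Bool)
  /-- the same for `Z` errors -/
  | fixZ (b : ℕ) (f : List Bool → Bool)
  /-- exchange of the labels of two blocks (no physical operation) -/
  | swap (b b' : ℕ)

/-- A procedure, as a list of operations. -/
abbrev Program := List Instr

/-- The error with which an operation fails on one strand; the second entry is used by
controlled-NOT gates only, and a measurement error is a bit flip just before the measurement. -/
abbrev Fault := Pauli × Pauli

/-- The probability of each fault of an operation. -/
def Instr.weight (r : Rates) : Instr → Fault → ℝ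
  | .prep _ a, φ => if φ.2 = I then weight1 (r.anc a) φ.1 else 0
  | .had _, φ => if φ.2 = I then weight1 r.one φ.1 else 0
  | .phase _, φ => if φ.2 = I then weight1 r.one φ.1 else 0
  | .cx _ _, φ => weight2 r.two φ.1 φ.2
  | .meas _, φ => if φ = (X, I) then r.meas else if φ = (I, I) then 1 - r.meas else 0
  | .fixX _ _, φ => if φ = (I, I) then 1 else 0
  | .fixZ _ _, φ => if φ = (I, I) then 1 else 0
  | .swap _ _, φ => if φ = (I, I) then 1 else 0

/-- Errors on one strand that are not yet known: which blocks carry an `X` or a `Z` error on this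
strand, and which of the measurements so far (most recent first) gave a flipped result. -/
structure State where
  x : ℕ → Bool
  z : ℕ → Bool
  out : List Bool

/-- The strand without errors. -/
def State.clean : State := ⟨fun _ => false, fun _ => false, []⟩

/-- A Pauli error hits block `b` of the strand. -/
def State.hit (s : State) (b : ℕ) (P : Pauli) : State :=
  ⟨Function.update s.x b (s.x b ^^ P.xbit), Function.update s.z b (s.z b ^^ P.zbit), s.out⟩

/-- Propagation of the errors through an ideal operation, followed by the fault `φ`. -/
def Instr.step : Instr → Fault → State → State
  | .prep b _, φ, s =>
      ⟨Function.update s.x b φ.1.xbit, Function.update s.z b φ.1.zbit, s.out⟩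
  | .had b, φ, s =>
      State.hit ⟨Function.update s.x b (s.z b), Function.update s.z b (s.x b), s.out⟩ b φ.1
  | .phase b, φ, s =>
      State.hit ⟨s.x, Function.update s.z b (s.z b ^^ s.x b), s.out⟩ b φ.1
  | .cx c t, φ, s =>
      State.hit (State.hit ⟨Function.update s.x t (s.x t ^^ s.x c),
        Function.update s.z c (s.z c ^^ s.z t), s.out⟩ c φ.1) t φ.2
  | .meas b, φ, s => ⟨s.x, s.z, (s.x b ^^ φ.1.xbit) :: s.out⟩
  | .fixX b f, _, s => ⟨Function.update s.x b (s.x b ^^ f s.out), s.z, s.out⟩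
  | .fixZ b f, _, s => ⟨s.x, Function.update s.z b (s.z b ^^ f s.out), s.out⟩
  | .swap b b', _, s => ⟨s.x ∘ Equiv.swap b b', s.z ∘ Equiv.swap b b', s.out⟩

/-- The final state of a strand, given the faults of all operations on it. -/
def run : (p : Program) → (Fin p.length → Fault) → State → State
  | [], _, s => s
  | i :: p, ω, s => run p (fun j => ω j.succ) (i.step (ω 0) s)

/-- Probability of a pattern of faults on one strand: gate failures are uncorrelated. -/
def strandWeight (r : Rates) (p : Program) (ω : Fin p.length → Fault) : ℝ :=
  ∏ j, (p.get j).weight r (ω j)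

/-- The number of measurement steps. -/
def measCount (p : Program) : ℕ :=
  p.countP fun i => match i with
    | .meas _ => true
    | _ => false

/-- Is the result of measurement step `L` (counted from `0`) flipped on this strand? -/
def State.errorAt (s : State) (L : ℕ) : Bool := s.out.reverse.getD L false

open Classical in
/-- The single-strand error probability at measurement step `L`. -/
def strandError (r : Rates) (p : Program) (L : ℕ) : ℝ :=
  ∑ ω : Fin p.length → Fault,
    if (run p ω State.clean).errorAt L = true then strandWeight r p ω else 0

open Classical in
/-- Probability of an event for a homogeneous procedure with blocks of `n` qubits: `n` strands with
independent, identically distributed faults. -/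
def blockProb (r : Rates) (p : Program) (n : ℕ) (E : (Fin n → State) → Prop) : ℝ :=
  ∑ ω : Fin n → Fin p.length → Fault,
    if E (fun s => run p (ω s) State.clean) then ∏ s, strandWeight r p (ω s) else 0

/-- Encoded failure at measurement step `L`: more than `t` qubits of the measured block are in
error, so that proper decoding is not guaranteed.  Otherwise the errors are located. -/
def FailsAt (t L : ℕ) {n : ℕ} (σ : Fin n → State) : Prop :=
  t < (Finset.univ.filter fun s => (σ s).errorAt L = true).card

/-- Probability of an encoded failure at measurement step `L`. -/
def failProb (r : Rates) (p : Program) (n t L : ℕ) : ℝ :=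
  blockProb r p n (FailsAt t L)

/-- Probability that some measurement step of the procedure fails. -/
def anyFailProb (r : Rates) (p : Program) (n t : ℕ) : ℝ :=
  blockProb r p n fun σ => ∃ L < measCount p, FailsAt t L σ

/-! ## The three fault-tolerant procedures -/

inductive Procedure where
  | singleSteane | doubleSteane | knill
  deriving DecidableEq

/-- Encoded gates; `idle` is the step without a gate, and `pt` is the teleportation circuit that
implements either of the gates `P`, `T`. -/
inductive Gate where
  | idle | had | cx | pt
  deriving DecidableEq

/-- The error of the last measurement. -/
def lastOne : List Bool → Bool
  | a :: _ => a
  | _ => false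

/-- Both of the last two measurements were in error. -/
def lastBoth : List Bool → Bool
  | a :: b :: _ => a && b
  | _ => false

/-- Coupling of the data block `d` to an `A`-type ancilla that is then measured: `X` errors. -/
def coupleX (d : ℕ) : Program := [.prep 0 A, .cx d 0, .meas 0]

/-- Coupling of the data block `d` to a `B`-type ancilla that is then measured: `Z` errors. -/
def coupleZ (d : ℕ) : Program := [.prep 0 B, .cx 0 d, .had 0, .meas 0]

/-- Steane's correction of `X` errors.  With double coupling, the qubits implicated both times are
presumed to be in error. -/
def corrX : Procedure → ℕ → Program
  | .doubleSteane, d => coupleX d ++ coupleX d ++ [.fixX d lastBoth]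
  | _, d => coupleX d ++ [.fixX d lastOne]

/-- Steane's correction of `Z` errors. -/
def corrZ : Procedure → ℕ → Program
  | .doubleSteane, d => coupleZ d ++ coupleZ d ++ [.fixZ d lastBoth]
  | _, d => coupleZ d ++ [.fixZ d lastOne]

/-- The two orders of error correction: `zx` corrects `Z` errors first and `X` errors last. -/
inductive Order where
  | zx | xz
  deriving DecidableEq

def Order.flip : Order → Order
  | .zx => .xz
  | .xz => .zx

/-- Steane's error correction of a data block in the given order. -/
def correct (m : Procedure) (d : ℕ) : Order → Program
  | .zx => corrZ m d ++ corrX m d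
  | .xz => corrX m d ++ corrZ m d

/-- Knill's teleportation with the data as control.  The surviving half of the two-block ancilla,
whose qubits have independent errors of their own, is the input of the next encoded gate. -/
def teleA (d : ℕ) : Program := [.prep 0 A, .cx d 0, .had d, .meas d, .meas 0]

/-- Knill's teleportation with the data as target. -/
def teleB (d : ℕ) : Program := [.prep 0 B, .cx 0 d, .meas d, .had 0, .meas 0]

/-- Encoded gates of Knill's procedure on the blocks `d` (and `e`, the target).  An input block is
the surviving half of the ancilla of the preceding teleportation, hence it has the error
distribution of an ancilla. -/
def knillGate (d e : ℕ) : Gate → Program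
  | .idle | .pt => [.prep d B] ++ teleA d
  | .had => [.prep d B, .had d] ++ teleB d
  | .cx => [.prep d B, .prep e A, .cx d e] ++ teleA d ++ teleB e

/-- The initial error correction of the circuit in which an encoded gate is analyzed. -/
def gateLead : Procedure → Gate → Program
  | .knill, _ => []
  | m, .idle => correct m 2 .zx
  | m, .had => correct m 2 .zx
  | m, .cx => correct m 2 .zx ++ correct m 3 .xz
  | m, .pt => correct m 2 .xz

/-- The rest of that circuit. -/
def gateBody : Procedure → Gate → Program
  | .knill, g => knillGate 2 3 g
  | m, .idle => correct m 2 .xz ++ correct m 2 .zx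
  | m, .had => [.had 2] ++ correct m 2 .xz
  | m, .cx => [.cx 2 3] ++ correct m 2 .zx ++ correct m 3 .xz
  | .singleSteane, .pt => [.prep 1 B, .cx 1 2, .meas 2] ++ coupleZ 1 ++ [.fixZ 1 lastOne]
  | .doubleSteane, .pt => [.prep 1 B, .cx 1 2, .meas 2] ++ coupleZ 1 ++ coupleZ 1 ++
      [.fixZ 1 lastBoth] ++ coupleX 1 ++ [.fixX 1 lastOne]

/-- The maximal single-strand error probability of an encoded gate: the maximum over the measurement
steps that follow the initial error correction. -/
def gateMax (r : Rates) (m : Procedure) (g : Gate) : ℝ :=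
  ⨆ L : Fin (measCount (gateBody m g)),
    strandError r (gateLead m g ++ gateBody m g) (measCount (gateLead m g) + L)

/-- The first-order expressions for the maximal single-strand error probabilities. -/
def gateTable (r : Rates) : Procedure → Gate → ℝ
  | .singleSteane, .idle =>
    max
      (4 * (r.two Y I + r.two Y X + r.two Z I + r.two Z X) + 3 * (r.two Y Y + r.two Y Z +
        r.two Z Y + r.two Z Z) + 2 * (r.one X + r.one Y + r.meas + r.anc A Y + r.anc A Z +
        r.anc B Y + r.anc B Z) + r.two I Y + r.two I Z + r.two X Y + r.two X Z)
      (4 * (r.two I X + r.two I Y + r.two Z X + r.two Z Y) + 3 * (r.two X X + r.two X Y +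
        r.two Y X + r.two Y Y) + 2 * (r.meas + r.anc A X + r.anc A Y + r.anc B X + r.anc B Y) +
        r.two X I + r.two X Z + r.two Y I + r.two Y Z)
  | .singleSteane, .had =>
    max
      (3 * (r.two Y X + r.two Z X) + 2 * (r.one X + r.one Y + r.meas + r.two I Y + r.two X Y +
        r.two Y I + r.two Y Y + r.two Z I + r.two Z Y + r.anc A Y) + r.two I X + r.two I Z +
        r.two X X + r.two X Z + r.two Y Z + r.two Z Z + r.anc A X + r.anc A Z + r.anc B Y +
        r.anc B Z)
      (3 * (r.two Y I + r.two Y Z + r.two Z X + r.two Z Y) + 2 * (r.one Y + r.meas + r.two Y X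
        + r.two Y Y + r.two Z I + r.two Z Z + r.anc A Y) + r.one X + r.one Z + r.two I X +
        r.two I Y + r.two X I + r.two X Z + r.anc A X + r.anc A Z + r.anc B Y + r.anc B Z)
  | .singleSteane, .cx =>
    max
      (5 * (r.two Y I + r.two Y X + r.two Z I + r.two Z X) + 3 * (r.one X + r.one Y + r.meas +
        r.two Y Y + r.two Y Z + r.two Z Y + r.two Z Z + r.anc B Y + r.anc B Z) + 2 * (r.two I Y
        + r.two I Z + r.two X Y + r.two X Z) + r.anc A Y + r.anc A Z)
      (5 * (r.two I X + r.two I Y + r.two Z X + r.two Z Y) + 3 * (r.meas + r.two X X +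
        r.two X Y + r.two Y X + r.two Y Y + r.anc A X + r.anc A Y) + 2 * (r.two X I + r.two X Z
        + r.two Y I + r.two Y Z) + r.anc B X + r.anc B Y)
  | .singleSteane, .pt =>
    max
      (3 * (r.two I X + r.two I Y + r.two Z X + r.two Z Y) + 2 * (r.meas + r.two X X +
        r.two X Y + r.two Y X + r.two Y Y + r.anc B X + r.anc B Y) + r.two X I + r.two X Z +
        r.two Y I + r.two Y Z + r.anc A X + r.anc A Y)
      (3 * (r.two Y I + r.two Y X + r.two Z I + r.two Z X + r.anc B Y + r.anc B Z) +
        2 * (r.one X + r.one Y + r.meas + r.two Y Y + r.two Y Z + r.two Z Y + r.two Z Z) +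
        r.two I Y + r.two I Z + r.two X Y + r.two X Z)
  | .doubleSteane, .idle =>
    max
      (7 * (r.two Y Y + r.two Y Z + r.two Z Y + r.two Z Z) + 5 * (r.two Y I + r.two Y X +
        r.two Z I + r.two Z X) + 4 * (r.anc A Y + r.anc A Z) + 3 * (r.two I Y + r.two I Z +
        r.two X Y + r.two X Z) + r.one X + r.one Y + r.meas + r.anc B Y + r.anc B Z)
      (7 * (r.two X X + r.two X Y + r.two Y X + r.two Y Y) + 5 * (r.two I X + r.two I Y +
        r.two Z X + r.two Z Y) + 4 * (r.anc B X + r.anc B Y) + 3 * (r.two X I + r.two X Z +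
        r.two Y I + r.two Y Z) + r.meas + r.anc A X + r.anc A Y)
  | .doubleSteane, .had =>
    max
      (5 * (r.two Y Y) + 4 * (r.two X Y + r.two Y X + r.two Y Z + r.two Z Y) + 3 * (r.two I Y +
        r.two X Z + r.two Y I + r.two Z X + r.two Z Z + r.anc A Y) + 2 * (r.two I Z + r.two X X
        + r.two Z I + r.anc A Z) + r.one X + r.one Y + r.meas + r.two I X + r.two X I +
        r.anc A X)
      (6 * (r.two Y Z) + 5 * (r.two Y I + r.two Y Y) + 4 * (r.two Y X + r.two Z Y + r.two Z Z)
        + 3 * (r.two X Z + r.two Z I + r.two Z X) + 2 * (r.one Y + r.two X I + r.two X Y +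
        r.anc A Y + r.anc A Z) + r.one X + r.one Z + r.meas + r.two I Y + r.two I Z + r.two X X
        + r.anc B Y + r.anc B Z)
  | .doubleSteane, .cx =>
    max
      (7 * (r.two Y Y + r.two Y Z + r.two Z Y + r.two Z Z) + 5 * (r.two I Y + r.two I Z +
        r.two X Y + r.two X Z) + 4 * (r.two Y I + r.two Y X + r.two Z I + r.two Z X) +
        2 * (r.anc A Y + r.anc A Z) + r.one X + r.one Y + r.meas + r.anc B Y + r.anc B Z)
      (7 * (r.two X X + r.two X Y + r.two Y X + r.two Y Y) + 5 * (r.two X I + r.two X Z +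
        r.two Y I + r.two Y Z) + 4 * (r.two I X + r.two I Y + r.two Z X + r.two Z Y) +
        2 * (r.anc B X + r.anc B Y) + r.meas + r.anc A X + r.anc A Y)
  | .doubleSteane, .pt =>
    max
      (4 * (r.two X X + r.two X Y + r.two Y X + r.two Y Y) + 3 * (r.two I X + r.two I Y +
        r.two Z X + r.two Z Y + r.anc B X + r.anc B Y) + 2 * (r.two X I + r.two X Z + r.two Y I
        + r.two Y Z) + r.meas)
      (max
      (4 * (r.two Y Y + r.two Y Z + r.two Z Y + r.two Z Z) + 3 * (r.two I Y + r.two I Z +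
        r.two X Y + r.two X Z) + 2 * (r.two Y I + r.two Y X + r.two Z I + r.two Z X + r.anc B Y
        + r.anc B Z) + r.one X + r.one Y + r.meas)
      (4 * (r.two X X + r.two X Y + r.two Y X + r.two Y Y) + 3 * (r.two I X + r.two I Y +
        r.two Z X + r.two Z Y + r.anc B X + r.anc B Y) + r.meas + r.two X I + r.two X Z +
        r.two Y I + r.two Y Z + r.anc A X + r.anc A Y))
  | .knill, .idle | .knill, .pt =>
    max
      (r.one X + r.one Y + r.meas + r.two Y I + r.two Y X + r.two Y Y + r.two Y Z + r.two Z I +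
        r.two Z X + r.two Z Y + r.two Z Z + r.anc A Y + r.anc A Z + r.anc B Y + r.anc B Z)
      (r.meas + r.two I X + r.two I Y + r.two X X + r.two X Y + r.two Y X + r.two Y Y +
        r.two Z X + r.two Z Y + r.anc A X + r.anc A Y + r.anc B X + r.anc B Y)
  | .knill, .had =>
    max
      (2 * (r.anc B Y) + r.one X + r.one Y + r.meas + r.two I X + r.two I Y + r.two X X +
        r.two X Y + r.two Y X + r.two Y Y + r.two Z X + r.two Z Y + r.anc B X + r.anc B Z)
      (2 * (r.one Y + r.anc B Y) + r.one X + r.one Z + r.meas + r.two Y I + r.two Y X +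
        r.two Y Y + r.two Y Z + r.two Z I + r.two Z X + r.two Z Y + r.two Z Z + r.anc B X +
        r.anc B Z)
  | .knill, .cx =>
    max
      (2 * (r.two Y I + r.two Y X + r.two Y Y + r.two Y Z + r.two Z I + r.two Z X + r.two Z Y +
        r.two Z Z + r.anc A Y + r.anc A Z) + r.one X + r.one Y + r.meas + r.anc B Y + r.anc B Z)
      (max
      (2 * (r.two X X + r.two X Y + r.two Y X + r.two Y Y) + r.meas + r.two I X + r.two I Y +
        r.two X I + r.two X Z + r.two Y I + r.two Y Z + r.two Z X + r.two Z Y + r.anc A X +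
        r.anc A Y + r.anc B X + r.anc B Y)
      (max
      (2 * (r.two I X + r.two I Y + r.two X X + r.two X Y + r.two Y X + r.two Y Y + r.two Z X +
        r.two Z Y + r.anc B X + r.anc B Y) + r.meas + r.anc A X + r.anc A Y)
      (2 * (r.two Y Y + r.two Y Z + r.two Z Y + r.two Z Z) + r.one X + r.one Y + r.meas +
        r.two I Y + r.two I Z + r.two X Y + r.two X Z + r.two Y I + r.two Y X + r.two Z I +
        r.two Z X + r.anc A Y + r.anc A Z + r.anc B Y + r.anc B Z)))

/-- The maximum of the first-order expressions over all encoded gates of a procedure. -/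
def tableMax (r : Rates) (m : Procedure) : ℝ :=
  max (max (gateTable r m .idle) (gateTable r m .had))
    (max (gateTable r m .cx) (gateTable r m .pt))

/-! ## Encoded computations -/

/-- Steps of an encoded computation on logical qubits labelled by natural numbers: preparation of
a logical state by means of an ancilla, the idle step that changes the order of error correction,
and the encoded gates. -/
inductive Op where
  | init (q : ℕ)
  | idle (q : ℕ)
  | had (q : ℕ)
  | cx (c t : ℕ)
  | pt (q : ℕ)

/-- The order of the most recent error correction of every logical qubit in use. -/
abbrev Orders := ℕ → Option Order

/-- For Steane's method a step has to find its qubits corrected in the order with which the circuit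
of the encoded gate begins. -/
def Op.Admissible (m : Procedure) (o : Orders) : Op → Prop
  | .init _ => True
  | .idle q => m = .knill ∨ o q ≠ none
  | .had q => m = .knill ∨ o q = some .zx
  | .cx c t => c ≠ t ∧ (m = .knill ∨ (o c = some .zx ∧ o t = some .xz))
  | .pt q => m = .knill ∨ o q = some .xz

def Op.next (o : Orders) : Op → Orders
  | .init q => Function.update o q (some .zx)
  | .idle q => Function.update o q ((o q).map Order.flip)
  | .had q => Function.update o q (some .xz)
  | .cx _ _ => o
  | .pt q => Function.update o q (some .zx)

/-- The operations of a step; logical qubit `q` is held by block `q + 2`.  In Steane's method the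
error correction that ends one step is the initial error correction of the next one. -/
def Op.code (m : Procedure) (o : Orders) : Op → Program
  | .init q => match m with
      | .knill => []
      | m => [.prep (q + 2) B] ++ correct m (q + 2) .zx
  | .idle q => match m, o q with
      | .knill, _ => knillGate (q + 2) 0 .idle
      | m, some a => correct m (q + 2) a.flip
      | _, none => []
  | .had q => match m with
      | .knill => knillGate (q + 2) 0 .had
      | m => [.had (q + 2)] ++ correct m (q + 2) .xz
  | .cx c t => match m with
      | .knill => knillGate (c + 2) (t + 2) .cx
      | m => [.cx (c + 2) (t + 2)] ++ correct m (c + 2) .zx ++ correct m (t + 2) .xz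
  | .pt q => match m with
      | .knill => knillGate (q + 2) 0 .pt
      | m => [.prep 1 B, .cx 1 (q + 2), .meas (q + 2), .swap 1 (q + 2)] ++
          correct m (q + 2) .zx

/-- Is a sequence of steps an admissible encoded computation? -/
def AdmissibleFrom (m : Procedure) : Orders → List Op → Prop
  | _, [] => True
  | o, a :: l => a.Admissible m o ∧ AdmissibleFrom m (a.next o) l

def codeFrom (m : Procedure) : Orders → List Op → Program
  | _, [] => []
  | o, a :: l => a.code m o ++ codeFrom m (a.next o) l

/-- Encoded computations, starting without any logical qubit prepared. -/
def Admissible (m : Procedure) (l : List Op) : Prop := AdmissibleFrom m (fun _ => none) l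

/-- The homogeneous procedure that carries out an encoded computation. -/
def compile (m : Procedure) (l : List Op) : Program := codeFrom m (fun _ => none) l

/-! ## Reduced error models with one parameter -/

inductive Model where
  | m1 | m2 | m3 | m4
  deriving DecidableEq

/-- Ancilla errors of the reduced models. -/
def ancRates (xA yA zA xB yB zB : ℝ) : Anc → Pauli → ℝ
  | .A, .X => xA | .A, .Y => yA | .A, .Z => zA
  | .B, .X => xB | .B, .Y => yB | .B, .Z => zB
  | _, .I => 0

/-- `m1`: depolarizing errors; `m2`: depolarizing errors with increased measurement errors;
`m3`: depolarizing errors of two-qubit gates only; `m4`: restricted errors of two-qubit gates. -/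
def Model.rates (p : ℝ) : Model → Rates
  | .m1 => ⟨fun _ => p / 4, fun _ _ => p / 16, p / 2,
      ancRates (p / 4) (p / 8) (p / 8) (p / 8) (p / 8) (p / 4)⟩
  | .m2 => ⟨fun _ => 4 * p / 15, fun _ _ => p / 15, 4 * p,
      ancRates (4 * p / 15) (2 * p / 15) (2 * p / 15) (2 * p / 15) (2 * p / 15) (4 * p / 15)⟩
  | .m3 => ⟨fun _ => 0, fun _ _ => p / 15, 0,
      ancRates (4 * p / 15) (2 * p / 15) (2 * p / 15) (2 * p / 15) (2 * p / 15) (4 * p / 15)⟩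
  | .m4 => ⟨fun _ => 0,
      fun P Q => if (P, Q) = (I, X) ∨ (P, Q) = (X, I) ∨ (P, Q) = (I, Z) ∨ (P, Q) = (Z, I)
        then p / 4 else 0, 0,
      ancRates (p / 2) 0 (p / 4) (p / 4) 0 (p / 2)⟩

/-- Threshold coefficients, in units of the correctable fraction. -/
def coeff : Procedure → Model → ℝ
  | .singleSteane, .m1 => 8 / 55 | .singleSteane, .m2 => 15 / 266
  | .singleSteane, .m3 => 15 / 62 | .singleSteane, .m4 => 2 / 7
  | .doubleSteane, .m1 => 8 / 49 | .doubleSteane, .m2 => 1 / 10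
  | .doubleSteane, .m3 => 15 / 82 | .doubleSteane, .m4 => 2 / 7
  | .knill, .m1 => 8 / 23 | .knill, .m2 => 15 / 98
  | .knill, .m3 => 1 / 2 | .knill, .m4 => 2 / 3

/-- The same coefficients rounded to two decimals. -/
def coeffRounded : Procedure → Model → ℝ
  | .singleSteane, .m1 => 0.15 | .singleSteane, .m2 => 0.06
  | .singleSteane, .m3 => 0.24 | .singleSteane, .m4 => 0.29
  | .doubleSteane, .m1 => 0.16 | .doubleSteane, .m2 => 0.10
  | .doubleSteane, .m3 => 0.18 | .doubleSteane, .m4 => 0.29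
  | .knill, .m1 => 0.35 | .knill, .m2 => 0.15
  | .knill, .m3 => 0.50 | .knill, .m4 => 0.67

/-- With block size tending to infinity along the family, computation can continue indefinitely:
the probability that an encoded computation (with any number of steps) fails anywhere is at most
its number of measurement steps times a quantity that is exponentially small in the block size. -/
def ComputesIndefinitely (F : CodeFamily) (r : Rates) (m : Procedure) : Prop :=
  ∃ c > 0, ∀ᶠ k in atTop, ∀ l : List Op, Admissible m l →
    anyFailProb r (compile m l) (F.len k) (F.t k) ≤
      measCount (compile m l) * Real.exp (-c * F.len k)

end Homogeneous

end

/-!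
Faults act independently on the `n` strands, so the number of flipped results at a measurement is
binomially distributed with the single-strand error probability as its parameter
(`sum_prod_card_eq_binomial`). Chernoff bounds for the two tails and a union bound over the
measurements give the step function and the exponential bound for procedures of any length
(`CodeFamily.HasFraction.tendsto_failProb_one`, `CodeFamily.HasFraction.exists_anyFailProb_le`).

One strand is a Markov chain of error states, and `expect` is the corresponding expectation. A test
that is false without faults has, up to the probability that two faults coincide, the probability
`firstOrder`, the sum of the rates of all single faults that make it true
(`abs_expect_sub_firstOrder_le`). Errors propagate additively, and if the updates of the record are
additive too, then a union bound shows that `firstOrder` is an upper bound without any correction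
(`expect_le_firstOrder_of_linear`); this covers single coupling and Knill's method. The first-order
expressions are linear in the rates, with coefficients that count single faults. For fixed circuits
the kernel evaluates these counts and compares them with the table (`gate_coef_le`,
`exists_gate_coef_eq`, `coef_result_le`).

In a computation of arbitrary length the error probability of a measurement must not depend on the
history. In Knill's method every step starts from fresh ancillae. In Steane's method, error
correction without faults removes every error of a block, whatever it was (`err_ideal_stepCode`).
Hence at any time an error on a qubit has, to first order, the distribution that the most recent
error correction produces by itself, errors on two qubits at once are of second order, and these
statements, with fixed constants, are preserved by every step (`Inv.step`). For single coupling,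
where tests are additive, no second-order terms arise. A measurement is then bounded by the
contributions of the errors that enter its step and of the faults within the step, and in each case
the sum of these is dominated by an expression of the table (`Inv.expect_result_le`). Steps act on
arbitrary blocks; since the circuits are local, it suffices to evaluate them on standard labels
(`expect_rename`). The numbers 33 and 65 in the error terms bound the lengths of a step and of the
circuit of a gate (`length_stepCode`, `length_gateCircuit`).
-/

noncomputable section

namespace Homogeneous

open Pauli Anc

/-! ### Independent strands: the binomial law -/

open Classical in
/-- For `n` independent copies of a finite experiment with weights `W`, the number of copies in
which `B` occurs is binomially distributed. -/
theorem sum_prod_card_eq_binomial {Ω : Type*} [Fintype Ω] (W : Ω → ℝ) (hW : ∑ a, W a = 1)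
    (B : Ω → Prop) (n t : ℕ) :
    (∑ ω : Fin n → Ω, if t < (Finset.univ.filter fun s => B (ω s)).card then ∏ s, W (ω s) else 0) =
      ∑ i ∈ Finset.Icc (t + 1) n, (n.choose i : ℝ) * (∑ a, if B a then W a else 0) ^ i *
        (1 - ∑ a, if B a then W a else 0) ^ (n - i) := by
  set q : ℝ := ∑ a, if B a then W a else 0 with hq
  have hq' : (∑ a, if B a then 0 else W a) = 1 - q := by
    rw [← hW, hq, ← Finset.sum_sub_distrib]
    exact Finset.sum_congr rfl fun a _ => by split_ifs <;> simp
  -- the weight of all outcomes for which `B` occurs exactly in the copies of `A`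
  have key : ∀ A : Finset (Fin n),
      (∑ ω : Fin n → Ω, if (Finset.univ.filter fun s => B (ω s)) = A then ∏ s, W (ω s) else 0) =
        q ^ A.card * (1 - q) ^ (n - A.card) := by
    intro A
    have h1 : ∀ ω : Fin n → Ω,
        (if (Finset.univ.filter fun s => B (ω s)) = A then ∏ s, W (ω s) else 0) =
          ∏ s, if (B (ω s) ↔ s ∈ A) then W (ω s) else 0 := by
      intro ω
      split_ifs with h
      · refine Finset.prod_congr rfl fun s _ => ?_
        rw [if_pos]
        rw [← h]; simp
      · symm
        have : ∃ s, ¬ (B (ω s) ↔ s ∈ A) := by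
          by_contra hc
          push Not at hc
          exact h (by ext s; simpa using hc s)
        obtain ⟨s, hs⟩ := this
        exact Finset.prod_eq_zero (Finset.mem_univ s) (if_neg hs)
    rw [Finset.sum_congr rfl fun ω _ => h1 ω,
      ← Fintype.prod_sum (fun (s : Fin n) (a : Ω) => if (B a ↔ s ∈ A) then W a else 0)]
    have h2 : ∀ s : Fin n, (∑ a, if (B a ↔ s ∈ A) then W a else 0) =
        if s ∈ A then q else 1 - q := by
      intro s
      split_ifs with h
      · simp [h, hq]
      · rw [← hq']
        exact Finset.sum_congr rfl fun a _ => by by_cases hB : B a <;> simp [h, hB]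
    rw [Finset.prod_congr rfl fun s _ => h2 s, Finset.prod_ite]
    simp only [Finset.prod_const]
    congr 2
    · simp
    · rw [Finset.filter_not, Finset.card_sdiff_of_subset (Finset.filter_subset _ _)]
      simp
  calc _ = ∑ ω : Fin n → Ω, ∑ A : Finset (Fin n),
        (if t < A.card then
          (if (Finset.univ.filter fun s => B (ω s)) = A then ∏ s, W (ω s) else 0) else 0) := by
        refine Finset.sum_congr rfl fun ω _ => ?_
        rw [Finset.sum_eq_single (Finset.univ.filter fun s => B (ω s))]
        · simp
        · intro A _ hA
          simp [hA.symm]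
        · simp
    _ = ∑ A : Finset (Fin n), if t < A.card then q ^ A.card * (1 - q) ^ (n - A.card) else 0 := by
        rw [Finset.sum_comm]
        refine Finset.sum_congr rfl fun A _ => ?_
        split_ifs with h
        · exact key A
        · simp
    _ = ∑ i ∈ Finset.range (n + 1),
          n.choose i • (if t < i then q ^ i * (1 - q) ^ (n - i) else 0) := by
        have := Finset.sum_powerset_apply_card (x := (Finset.univ : Finset (Fin n)))
          (fun i => if t < i then q ^ i * (1 - q) ^ (n - i) else 0)
        simpa using this
    _ = _ := by
        have hsub : Finset.Icc (t + 1) n ⊆ Finset.range (n + 1) := by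
          intro i hi
          simp only [Finset.mem_Icc, Finset.mem_range] at *
          omega
        rw [← Finset.sum_subset hsub]
        · refine Finset.sum_congr rfl fun i hi => ?_
          have : t < i := by
            simp only [Finset.mem_Icc] at hi
            omega
          simp [this, mul_assoc]
        · intro i hi hi'
          have : ¬ t < i := by
            simp only [Finset.mem_Icc, Finset.mem_range] at *
            omega
          simp [this]

/-! ### Chernoff bounds for binomial tails -/

/-- The upper tail of the binomial distribution. -/
def binomialTail (n t : ℕ) (q : ℝ) : ℝ :=
  ∑ i ∈ Finset.Icc (t + 1) n, (n.choose i : ℝ) * q ^ i * (1 - q) ^ (n - i)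

theorem binomialTail_nonneg {n t : ℕ} {q : ℝ} (h0 : 0 ≤ q) (h1 : q ≤ 1) :
    0 ≤ binomialTail n t q :=
  Finset.sum_nonneg fun i _ => by
    have : 0 ≤ 1 - q := by linarith
    positivity

theorem binomial_mgf_le {n : ℕ} {q l : ℝ} (h0 : 0 ≤ q) (h1 : q ≤ 1) :
    ∑ i ∈ Finset.range (n + 1), Real.exp (l * i) * ((n.choose i : ℝ) * q ^ i * (1 - q) ^ (n - i)) ≤
      Real.exp (n * (q * (Real.exp l - 1))) := by
  have e : ∑ i ∈ Finset.range (n + 1),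
      Real.exp (l * i) * ((n.choose i : ℝ) * q ^ i * (1 - q) ^ (n - i)) =
      (q * Real.exp l + (1 - q)) ^ n := by
    rw [add_pow]
    refine Finset.sum_congr rfl fun i _ => ?_
    rw [mul_pow, ← Real.exp_nat_mul, mul_comm l]
    ring
  rw [e, Real.exp_nat_mul]
  have hexp := Real.exp_pos l
  refine pow_le_pow_left₀ (by nlinarith) ?_ n
  have := Real.add_one_le_exp (q * (Real.exp l - 1))
  linarith

theorem binomialTail_le_exp {n t : ℕ} {q l : ℝ} (h0 : 0 ≤ q) (h1 : q ≤ 1) (hl : 0 ≤ l) :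
    binomialTail n t q ≤ Real.exp (n * (q * (Real.exp l - 1)) - l * t) := by
  have hq : 0 ≤ 1 - q := by linarith
  have hterm : ∀ i : ℕ, 0 ≤ (n.choose i : ℝ) * q ^ i * (1 - q) ^ (n - i) := fun i => by positivity
  rw [sub_eq_add_neg, Real.exp_add]
  refine le_trans ?_ (mul_le_mul_of_nonneg_right (binomial_mgf_le (n := n) (l := l) h0 h1)
    (Real.exp_pos _).le)
  rw [Finset.sum_mul, binomialTail]
  have hsub : Finset.Icc (t + 1) n ⊆ Finset.range (n + 1) := by
    intro i hi
    simp only [Finset.mem_Icc, Finset.mem_range] at *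
    omega
  refine le_trans (Finset.sum_le_sum fun i hi => ?_)
    (Finset.sum_le_sum_of_subset_of_nonneg hsub fun i _ _ =>
      mul_nonneg (mul_nonneg (Real.exp_pos _).le (hterm i)) (Real.exp_pos _).le)
  rw [mul_right_comm (Real.exp _), ← Real.exp_add]
  refine le_mul_of_one_le_left (hterm i) (Real.one_le_exp ?_)
  have : (t : ℝ) ≤ i := by
    simp only [Finset.mem_Icc] at hi
    exact_mod_cast (by omega : t ≤ i)
  nlinarith

theorem one_sub_binomialTail_le_exp {n t : ℕ} {q l : ℝ} (h0 : 0 ≤ q) (h1 : q ≤ 1) (hl : 0 ≤ l) :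
    1 - binomialTail n t q ≤ Real.exp (n * (q * (Real.exp (-l) - 1)) + l * t) := by
  have hq : 0 ≤ 1 - q := by linarith
  have hterm : ∀ i : ℕ, 0 ≤ (n.choose i : ℝ) * q ^ i * (1 - q) ^ (n - i) := fun i => by positivity
  have htot : ∑ i ∈ Finset.range (n + 1), (n.choose i : ℝ) * q ^ i * (1 - q) ^ (n - i) = 1 := by
    have := add_pow q (1 - q) n
    rw [add_sub_cancel, one_pow] at this
    refine Eq.trans ?_ this.symm
    exact Finset.sum_congr rfl fun i _ => by ring
  have hsub : Finset.Icc (t + 1) n ⊆ Finset.range (n + 1) := by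
    intro i hi
    simp only [Finset.mem_Icc, Finset.mem_range] at *
    omega
  rw [Real.exp_add]
  refine le_trans ?_ (mul_le_mul_of_nonneg_right (binomial_mgf_le (n := n) (l := -l) h0 h1)
    (Real.exp_pos _).le)
  have hsplit := Finset.sum_sdiff hsub
    (f := fun i => (n.choose i : ℝ) * q ^ i * (1 - q) ^ (n - i))
  rw [htot] at hsplit
  rw [binomialTail, sub_eq_of_eq_add hsplit.symm, Finset.sum_mul]
  refine le_trans (Finset.sum_le_sum fun i hi => ?_)
    (Finset.sum_le_sum_of_subset_of_nonneg Finset.sdiff_subset fun i _ _ =>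
      mul_nonneg (mul_nonneg (Real.exp_pos _).le (hterm i)) (Real.exp_pos _).le)
  rw [mul_right_comm (Real.exp _), ← Real.exp_add]
  refine le_mul_of_one_le_left (hterm i) (Real.one_le_exp ?_)
  have : (i : ℝ) ≤ t := by
    simp only [Finset.mem_sdiff, Finset.mem_Icc, Finset.mem_range] at hi
    exact_mod_cast (by omega : i ≤ t)
  nlinarith

theorem exp_sub_one_le_of_le_one {l : ℝ} (h0 : 0 ≤ l) (h1 : l ≤ 1) :
    Real.exp l - 1 ≤ l + l ^ 2 := by
  have := Real.abs_exp_sub_one_sub_id_le (x := l) (by rwa [abs_of_nonneg h0])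
  have := (abs_le.1 this).2
  linarith

theorem exp_neg_sub_one_le_of_le_one {l : ℝ} (h0 : 0 ≤ l) (h1 : l ≤ 1) :
    Real.exp (-l) - 1 ≤ -l + l ^ 2 := by
  have := Real.abs_exp_sub_one_sub_id_le (x := -l) (by rwa [abs_neg, abs_of_nonneg h0])
  have := (abs_le.1 this).2
  nlinarith

/-- Below a fraction `q₁` of errors, uniformly in `q ≤ q₀ < q₁`, the tail is exponentially small. -/
theorem binomialTail_le_of_lt {n t : ℕ} {q q₀ q₁ : ℝ} (h0 : 0 ≤ q) (hq : q ≤ q₀) (hq₁ : q₀ < q₁)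
    (h1 : q₁ ≤ 1) (ht : q₁ * n ≤ t) :
    binomialTail n t q ≤ Real.exp (-((q₁ - q₀) ^ 2 / 4) * n) := by
  -- the exponent is optimal to leading order at this value
  set l := (q₁ - q₀) / 2 with hl
  have hl0 : 0 ≤ l := by linarith
  have hl1 : l ≤ 1 := by linarith
  refine (binomialTail_le_exp h0 (by linarith) hl0).trans (Real.exp_le_exp.2 ?_)
  have h2 := exp_sub_one_le_of_le_one hl0 hl1
  have h3 : q * (Real.exp l - 1) ≤ q₀ * l + l ^ 2 := by
    have : q * (Real.exp l - 1) ≤ q * (l + l ^ 2) := mul_le_mul_of_nonneg_left h2 h0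
    nlinarith [mul_nonneg h0 hl0, sq_nonneg l]
  have hn : (0 : ℝ) ≤ n := Nat.cast_nonneg n
  have h4 : (n : ℝ) * (q * (Real.exp l - 1)) ≤ n * (q₀ * l + l ^ 2) :=
    mul_le_mul_of_nonneg_left h3 hn
  have h5 : l * (q₁ * n) ≤ l * t := mul_le_mul_of_nonneg_left ht hl0
  have : q₁ - q₀ = 2 * l := by rw [hl]; ring
  have h6 : q₁ = q₀ + 2 * l := by linarith
  rw [this]
  rw [h6] at h5
  nlinarith

theorem one_sub_binomialTail_le_of_lt {n t : ℕ} {q q₁ : ℝ} (h0 : 0 ≤ q₁) (hq₁ : q₁ < q)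
    (h1 : q ≤ 1) (ht : (t : ℝ) ≤ q₁ * n) :
    1 - binomialTail n t q ≤ Real.exp (-((q - q₁) ^ 2 / 4) * n) := by
  -- `l` minimizes `l ^ 2 - (q - q₁) * l`, which bounds the exponent divided by `n`
  set l := (q - q₁) / 2 with hl
  have hl0 : 0 ≤ l := by linarith
  have hl1 : l ≤ 1 := by linarith
  refine (one_sub_binomialTail_le_exp (by linarith) h1 hl0).trans (Real.exp_le_exp.2 ?_)
  have h2 := exp_neg_sub_one_le_of_le_one hl0 hl1
  have h3 : q * (Real.exp (-l) - 1) ≤ -q * l + l ^ 2 := by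
    have : q * (Real.exp (-l) - 1) ≤ q * (-l + l ^ 2) :=
      mul_le_mul_of_nonneg_left h2 (by linarith)
    nlinarith [sq_nonneg l]
  have hn : (0 : ℝ) ≤ n := Nat.cast_nonneg n
  have h4 : (n : ℝ) * (q * (Real.exp (-l) - 1)) ≤ n * (-q * l + l ^ 2) :=
    mul_le_mul_of_nonneg_left h3 hn
  have h5 : l * t ≤ l * (q₁ * n) := mul_le_mul_of_nonneg_left ht hl0
  have : q - q₁ = 2 * l := by rw [hl]; ring
  have h6 : q₁ = q - 2 * l := by linarith
  rw [this]
  rw [h6] at h5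
  nlinarith

/-! ### Weights of faults -/

theorem sum_pauli (f : Pauli → ℝ) : ∑ P, f P = f I + f X + f Y + f Z := by
  have : (Finset.univ : Finset Pauli) = {I, X, Y, Z} := rfl
  rw [this, Finset.sum_insert (by decide), Finset.sum_insert (by decide),
    Finset.sum_insert (by decide), Finset.sum_singleton]
  ring

theorem sum_weight1 (f : Pauli → ℝ) : ∑ P, weight1 f P = 1 := by
  simp only [sum_pauli, weight1, sum1]
  simp
  ring

theorem sum_weight2 (f : Pauli → Pauli → ℝ) : ∑ P, ∑ Q, weight2 f P Q = 1 := by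
  simp only [sum_pauli, weight2, sum2]
  simp
  ring

theorem sum_fault_of_snd (f : Pauli → ℝ) :
    ∑ φ : Fault, (if φ.2 = I then f φ.1 else 0) = ∑ P, f P := by
  rw [Fintype.sum_prod_type]
  exact Finset.sum_congr rfl fun P _ => by simp

theorem Instr.sum_weight (r : Rates) (i : Instr) : ∑ φ, i.weight r φ = 1 := by
  cases i <;> simp only [Instr.weight]
  case prep => rw [sum_fault_of_snd, sum_weight1]
  case had => rw [sum_fault_of_snd, sum_weight1]
  case phase => rw [sum_fault_of_snd, sum_weight1]
  case cx => rw [Fintype.sum_prod_type, sum_weight2]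
  case meas =>
    rw [Fintype.sum_prod_type]
    simp [sum_pauli]
  all_goals simp

theorem weight1_nonneg {f : Pauli → ℝ} (h : ∀ P, P ≠ I → 0 ≤ f P) (h1 : sum1 f ≤ 1) (P : Pauli) :
    0 ≤ weight1 f P := by
  unfold weight1
  split_ifs with hP
  · linarith
  · exact h P hP

theorem Instr.weight_nonneg {r : Rates} (hr : r.Valid) (i : Instr) (φ : Fault) :
    0 ≤ i.weight r φ := by
  cases i <;> simp only [Instr.weight]
  case prep b a =>
    split_ifs
    · exact weight1_nonneg (hr.anc_nonneg a) (hr.anc_le a) _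
    · exact le_rfl
  case had =>
    split_ifs
    · exact weight1_nonneg hr.one_nonneg hr.one_le _
    · exact le_rfl
  case phase =>
    split_ifs
    · exact weight1_nonneg hr.one_nonneg hr.one_le _
    · exact le_rfl
  case cx =>
    unfold weight2
    split_ifs with h
    · linarith [hr.two_le]
    · exact hr.two_nonneg _ _ h
  case meas =>
    split_ifs
    · exact hr.meas_nonneg
    · linarith [hr.meas_le]
    · exact le_rfl
  all_goals split_ifs <;> norm_num

theorem strandWeight_nonneg {r : Rates} (hr : r.Valid) (p : Program) (ω : Fin p.length → Fault) :
    0 ≤ strandWeight r p ω :=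
  Finset.prod_nonneg fun _ _ => Instr.weight_nonneg hr _ _

theorem sum_strandWeight (r : Rates) (p : Program) : ∑ ω, strandWeight r p ω = 1 := by
  unfold strandWeight
  rw [← Fintype.prod_sum (fun (j : Fin p.length) (φ : Fault) => (p.get j).weight r φ)]
  exact Finset.prod_eq_one fun j _ => Instr.sum_weight r _

theorem strandError_nonneg {r : Rates} (hr : r.Valid) (p : Program) (L : ℕ) :
    0 ≤ strandError r p L :=
  Finset.sum_nonneg fun ω _ => by
    split_ifs
    · exact strandWeight_nonneg hr p ω
    · exact le_rfl

theorem strandError_le_one {r : Rates} (hr : r.Valid) (p : Program) (L : ℕ) :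
    strandError r p L ≤ 1 := by
  rw [← sum_strandWeight r p]
  refine Finset.sum_le_sum fun ω _ => ?_
  split_ifs
  · exact le_rfl
  · exact strandWeight_nonneg hr p ω

/-! ### Failure probabilities of blocks -/

theorem failProb_eq_binomialTail (r : Rates) (p : Program) (L n t : ℕ) :
    failProb r p n t L = binomialTail n t (strandError r p L) := by
  classical
  have := sum_prod_card_eq_binomial (strandWeight r p) (sum_strandWeight r p)
    (fun ω => (run p ω State.clean).errorAt L = true) n t
  unfold failProb blockProb FailsAt binomialTail strandError
  convert this

theorem blockProb_mono {r : Rates} (hr : r.Valid) (p : Program) (n : ℕ)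
    {E E' : (Fin n → State) → Prop} (h : ∀ σ, E σ → E' σ) :
    blockProb r p n E ≤ blockProb r p n E' := by
  classical
  refine Finset.sum_le_sum fun ω _ => ?_
  have h0 : 0 ≤ ∏ s, strandWeight r p (ω s) :=
    Finset.prod_nonneg fun s _ => strandWeight_nonneg hr p _
  split_ifs with h1 h2
  · exact le_rfl
  · exact absurd (h _ h1) h2
  · exact h0
  · exact le_rfl

theorem blockProb_true (r : Rates) (p : Program) (n : ℕ) :
    blockProb r p n (fun _ => True) = 1 := by
  unfold blockProb
  simp only [if_true]
  rw [← Fintype.prod_sum (fun (_ : Fin n) (ω : Fin p.length → Fault) => strandWeight r p ω)]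
  exact Finset.prod_eq_one fun j _ => sum_strandWeight r p

theorem anyFailProb_le_one {r : Rates} (hr : r.Valid) (p : Program) (n t : ℕ) :
    anyFailProb r p n t ≤ 1 := by
  rw [← blockProb_true r p n]
  exact blockProb_mono hr p n fun _ _ => trivial

theorem failProb_le_anyFailProb {r : Rates} (hr : r.Valid) (p : Program) (n t : ℕ) {L : ℕ}
    (hL : L < measCount p) : failProb r p n t L ≤ anyFailProb r p n t :=
  blockProb_mono hr p n fun _ h => ⟨L, hL, h⟩

theorem anyFailProb_le_sum {r : Rates} (hr : r.Valid) (p : Program) (n t : ℕ) :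
    anyFailProb r p n t ≤ ∑ L ∈ Finset.range (measCount p), failProb r p n t L := by
  classical
  unfold anyFailProb failProb blockProb
  rw [Finset.sum_comm]
  refine Finset.sum_le_sum fun ω _ => ?_
  have h0 : 0 ≤ ∏ s, strandWeight r p (ω s) :=
    Finset.prod_nonneg fun s _ => strandWeight_nonneg hr p _
  have hnn : ∀ L ∈ Finset.range (measCount p), 0 ≤ (if FailsAt t L (fun s =>
      run p (ω s) State.clean) then ∏ s, strandWeight r p (ω s) else 0) := fun L _ => by
    split_ifs
    · exact h0
    · exact le_rfl
  by_cases h : ∃ L < measCount p, FailsAt t L (fun s => run p (ω s) State.clean)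
  · rw [if_pos h]
    obtain ⟨L, hL, hf⟩ := h
    refine le_trans ?_ (Finset.single_le_sum hnn (Finset.mem_range.2 hL))
    rw [if_pos hf]
  · rw [if_neg h]
    exact Finset.sum_nonneg hnn

/-! ### Limits of large blocks -/

theorem CSSCode.correctable_le {n : ℕ} (C : CSSCode n) : C.correctable ≤ n := by
  by_cases h : {t : ℕ | t ≤ n ∧ C.Corrects t}.Nonempty
  · exact csSup_le h fun t ht => ht.1
  · rw [Set.not_nonempty_iff_eq_empty] at h
    simp [CSSCode.correctable, h]

theorem CodeFamily.HasFraction.nonneg {F : CodeFamily} {τ : ℝ} (h : F.HasFraction τ) : 0 ≤ τ :=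
  ge_of_tendsto' h fun k => by positivity

theorem CodeFamily.HasFraction.le_one {F : CodeFamily} {τ : ℝ} (h : F.HasFraction τ) : τ ≤ 1 :=
  le_of_tendsto' h fun k => div_le_one_of_le₀
    (by exact_mod_cast (F.code k).correctable_le) (Nat.cast_nonneg _)

theorem CodeFamily.HasFraction.eventually_le {F : CodeFamily} {τ : ℝ} (h : F.HasFraction τ)
    {q : ℝ} (hq : q < τ) : ∀ᶠ k in atTop, q * F.len k ≤ F.t k := by
  filter_upwards [h.eventually (lt_mem_nhds hq), F.unbounded.eventually (eventually_gt_atTop 0)]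
    with k hk hk0
  exact ((lt_div_iff₀ (by exact_mod_cast hk0)).1 hk).le

theorem CodeFamily.HasFraction.eventually_ge {F : CodeFamily} {τ : ℝ} (h : F.HasFraction τ)
    {q : ℝ} (hq : τ < q) : ∀ᶠ k in atTop, (F.t k : ℝ) ≤ q * F.len k := by
  filter_upwards [h.eventually (gt_mem_nhds hq), F.unbounded.eventually (eventually_gt_atTop 0)]
    with k hk hk0
  exact ((div_lt_iff₀ (by exact_mod_cast hk0)).1 hk).le

/-- Single-strand error probabilities that stay below the correctable fraction make the encoded
failures exponentially rare, uniformly over all rates, procedures and measurement steps. -/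
theorem CodeFamily.HasFraction.exists_failProb_le {F : CodeFamily} {τ : ℝ} (h : F.HasFraction τ)
    {q : ℝ} (hq : q < τ) :
    ∃ c > 0, ∀ᶠ k in atTop, ∀ r : Rates, r.Valid → ∀ (p : Program) (L : ℕ),
      strandError r p L ≤ q → failProb r p (F.len k) (F.t k) L ≤ Real.exp (-c * F.len k) := by
  obtain ⟨q₁, h1, h2⟩ := exists_between hq
  have hpos : 0 < q₁ - q := by linarith
  refine ⟨(q₁ - q) ^ 2 / 4, by positivity, ?_⟩
  filter_upwards [h.eventually_le h2] with k hk r hr p L hL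
  rw [failProb_eq_binomialTail]
  exact binomialTail_le_of_lt (strandError_nonneg hr p L) hL h1 (h2.le.trans h.le_one) hk

theorem CodeFamily.tendsto_exp_neg (F : CodeFamily) {c : ℝ} (hc : 0 < c) :
    Tendsto (fun k => Real.exp (-c * F.len k)) atTop (𝓝 0) := by
  refine Real.tendsto_exp_atBot.comp ?_
  exact (tendsto_natCast_atTop_atTop.comp F.unbounded).const_mul_atTop_of_neg (by linarith)

theorem CodeFamily.HasFraction.tendsto_failProb_zero {F : CodeFamily} {τ : ℝ}
    (h : F.HasFraction τ) {r : Rates} (hr : r.Valid) {p : Program} {L : ℕ}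
    (hL : strandError r p L < τ) :
    Tendsto (fun k => failProb r p (F.len k) (F.t k) L) atTop (𝓝 0) := by
  obtain ⟨c, hc, hev⟩ := h.exists_failProb_le hL
  refine tendsto_of_tendsto_of_tendsto_of_le_of_le' tendsto_const_nhds (F.tendsto_exp_neg hc)
    (Eventually.of_forall fun k => ?_) ?_
  · simp only [failProb_eq_binomialTail]
    exact binomialTail_nonneg (strandError_nonneg hr p L) (strandError_le_one hr p L)
  · filter_upwards [hev] with k hk
    exact hk r hr p L le_rfl

theorem CodeFamily.HasFraction.tendsto_failProb_one {F : CodeFamily} {τ : ℝ}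
    (h : F.HasFraction τ) {r : Rates} (hr : r.Valid) {p : Program} {L : ℕ}
    (hL' : L < measCount p) (hL : τ < strandError r p L) :
    Tendsto (fun k => failProb r p (F.len k) (F.t k) L) atTop (𝓝 1) ∧
      Tendsto (fun k => anyFailProb r p (F.len k) (F.t k)) atTop (𝓝 1) := by
  have main : Tendsto (fun k => failProb r p (F.len k) (F.t k) L) atTop (𝓝 1) := by
    obtain ⟨q₁, h1, h2⟩ := exists_between hL
    have hc : 0 < (strandError r p L - q₁) ^ 2 / 4 := by
      have : 0 < strandError r p L - q₁ := by linarith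
      positivity
    have hlow : Tendsto (fun k => 1 - Real.exp (-((strandError r p L - q₁) ^ 2 / 4) * F.len k))
        atTop (𝓝 1) := by
      simpa using (F.tendsto_exp_neg hc).const_sub 1
    refine tendsto_of_tendsto_of_tendsto_of_le_of_le' hlow tendsto_const_nhds ?_
      (Eventually.of_forall fun k =>
        (failProb_le_anyFailProb hr p _ _ hL').trans (anyFailProb_le_one hr p _ _))
    filter_upwards [h.eventually_ge h1] with k hk
    have := one_sub_binomialTail_le_of_lt (h.nonneg.trans h1.le) h2 (strandError_le_one hr p L) hk
    rw [failProb_eq_binomialTail]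
    linarith
  exact ⟨main, tendsto_of_tendsto_of_tendsto_of_le_of_le main tendsto_const_nhds
    (fun k => failProb_le_anyFailProb hr p _ _ hL') fun k => anyFailProb_le_one hr p _ _⟩

theorem CodeFamily.HasFraction.exists_anyFailProb_le {F : CodeFamily} {τ : ℝ}
    (h : F.HasFraction τ) {q : ℝ} (hq : q < τ) :
    ∃ c > 0, ∀ᶠ k in atTop, ∀ r : Rates, r.Valid → ∀ p : Program,
      (∀ L < measCount p, strandError r p L ≤ q) →
      anyFailProb r p (F.len k) (F.t k) ≤ measCount p * Real.exp (-c * F.len k) := by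
  obtain ⟨c, hc, hev⟩ := h.exists_failProb_le hq
  refine ⟨c, hc, ?_⟩
  filter_upwards [hev] with k hk r hr p hp
  refine (anyFailProb_le_sum hr p _ _).trans ?_
  refine (Finset.sum_le_sum fun L hL => hk r hr p L (hp L (Finset.mem_range.1 hL))).trans ?_
  simp

/-! ### A strand as a Markov chain -/

/-- Indicator of a Boolean, as a real number. -/
def ind (b : Bool) : ℝ := if b = true then 1 else 0

theorem ind_true : ind true = 1 := rfl

theorem ind_false : ind false = 0 := by simp [ind]

theorem ind_nonneg (b : Bool) : 0 ≤ ind b := by cases b <;> simp [ind]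

theorem ind_le_one (b : Bool) : ind b ≤ 1 := by cases b <;> simp [ind]

/-- Expected value of `g` in the state that the program `p` reaches from `s` on one strand. -/
def expect (r : Rates) : Program → (State → ℝ) → State → ℝ
  | [], g, s => g s
  | i :: p, g, s => ∑ φ, i.weight r φ * expect r p g (i.step φ s)

theorem sum_strandWeight_mul (r : Rates) (p : Program) (g : State → ℝ) (s : State) :
    ∑ ω, strandWeight r p ω * g (run p ω s) = expect r p g s := by
  induction p generalizing s with
  | nil => simp [strandWeight, run, expect]
  | cons i p ih =>
    rw [expect]
    refine Eq.trans ((Fin.consEquiv fun _ : Fin (p.length + 1) => Fault).sum_comp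
      (fun ω => strandWeight r (i :: p) ω * g (run (i :: p) ω s))).symm ?_
    rw [Fintype.sum_prod_type]
    refine Finset.sum_congr rfl fun φ _ => ?_
    rw [← ih, Finset.mul_sum]
    refine Finset.sum_congr rfl fun ω _ => ?_
    simp only [strandWeight, run, Fin.consEquiv, Equiv.coe_fn_mk, List.length_cons]
    rw [Fin.prod_univ_succ]
    simp [mul_assoc]

theorem strandError_eq_expect (r : Rates) (p : Program) (L : ℕ) :
    strandError r p L = expect r p (fun s => ind (s.errorAt L)) State.clean := by
  rw [← sum_strandWeight_mul]
  unfold strandError ind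
  refine Finset.sum_congr rfl fun ω _ => ?_
  simp

theorem expect_append (r : Rates) (p p' : Program) (g : State → ℝ) (s : State) :
    expect r (p ++ p') g s = expect r p (expect r p' g) s := by
  induction p generalizing s with
  | nil => rfl
  | cons i p ih =>
    simp only [List.cons_append, expect]
    exact Finset.sum_congr rfl fun φ _ => by rw [ih]

theorem expect_const (r : Rates) (p : Program) (c : ℝ) (s : State) :
    expect r p (fun _ => c) s = c := by
  induction p generalizing s with
  | nil => rfl
  | cons i p ih => simp only [expect, ih, ← Finset.sum_mul, Instr.sum_weight, one_mul]

theorem expect_add (r : Rates) (p : Program) (g h : State → ℝ) (s : State) :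
    expect r p (fun a => g a + h a) s = expect r p g s + expect r p h s := by
  induction p generalizing s with
  | nil => rfl
  | cons i p ih => simp only [expect, ih, mul_add, Finset.sum_add_distrib]

theorem expect_const_mul (r : Rates) (p : Program) (c : ℝ) (g : State → ℝ) (s : State) :
    expect r p (fun a => c * g a) s = c * expect r p g s := by
  induction p generalizing s with
  | nil => rfl
  | cons i p ih =>
    simp only [expect, ih, Finset.mul_sum]
    exact Finset.sum_congr rfl fun φ _ => by ring

theorem expect_mono {r : Rates} (hr : r.Valid) (p : Program) {g h : State → ℝ}
    (H : ∀ a, g a ≤ h a) (s : State) : expect r p g s ≤ expect r p h s := by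
  induction p generalizing s with
  | nil => exact H s
  | cons i p ih =>
    exact Finset.sum_le_sum fun φ _ =>
      mul_le_mul_of_nonneg_left (ih _) (Instr.weight_nonneg hr i φ)

theorem expect_nonneg {r : Rates} (hr : r.Valid) (p : Program) {g : State → ℝ}
    (H : ∀ a, 0 ≤ g a) (s : State) : 0 ≤ expect r p g s := by
  have := expect_mono hr p H s
  rwa [expect_const] at this

theorem expect_le_one {r : Rates} (hr : r.Valid) (p : Program) {g : State → ℝ}
    (H : ∀ a, g a ≤ 1) (s : State) : expect r p g s ≤ 1 := by
  have := expect_mono hr p H s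
  rwa [expect_const] at this

/-! ### First-order expansion -/

/-- Operation without a fault. -/
abbrev Instr.idealStep (i : Instr) (s : State) : State := i.step (I, I) s

/-- Propagation of errors through a program all of whose operations succeed. -/
def ideal : Program → State → State
  | [], s => s
  | i :: p, s => ideal p (i.idealStep s)

/-- The rate of a fault, and zero in place of the probability that there is none. -/
def Instr.rate (r : Rates) (i : Instr) (φ : Fault) : ℝ :=
  if φ = (I, I) then 0 else i.weight r φ

/-- Sum of the rates of all single faults of `p` for which the test `g` is true in the end. -/
def firstOrder (r : Rates) : Program → (State → Bool) → State → ℝ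
  | [], _, _ => 0
  | i :: p, g, s => ∑ φ, i.rate r φ * ind (g (ideal p (i.step φ s))) +
      firstOrder r p g (i.idealStep s)

theorem Instr.rate_nonneg {r : Rates} (hr : r.Valid) (i : Instr) (φ : Fault) :
    0 ≤ i.rate r φ := by
  unfold rate
  split_ifs
  · exact le_rfl
  · exact Instr.weight_nonneg hr i φ

/-- Separate the case without a fault. -/
theorem Instr.sum_weight_mul (r : Rates) (i : Instr) (f : Fault → ℝ) :
    ∑ φ, i.weight r φ * f φ = f (I, I) + ∑ φ, i.rate r φ * (f φ - f (I, I)) := by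
  have h : ∀ φ, i.rate r φ * (f φ - f (I, I)) = i.weight r φ * f φ - i.weight r φ * f (I, I) := by
    intro φ
    unfold rate
    split_ifs with h
    · subst h; ring
    · ring
  simp only [h, Finset.sum_sub_distrib, ← Finset.sum_mul, Instr.sum_weight]
  ring

theorem sum1_nonneg {f : Pauli → ℝ} (h : ∀ P, P ≠ I → 0 ≤ f P) : 0 ≤ sum1 f := by
  have h1 := h X (by decide)
  have h2 := h Y (by decide)
  have h3 := h Z (by decide)
  unfold sum1
  linarith

theorem sum2_nonneg {f : Pauli → Pauli → ℝ} (h : ∀ P Q, ¬ (P = I ∧ Q = I) → 0 ≤ f P Q) :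
    0 ≤ sum2 f :=
  Finset.sum_nonneg fun P _ => Finset.sum_nonneg fun Q _ => by
    split_ifs with hPQ
    · exact le_rfl
    · exact h P Q hPQ

theorem Rates.Valid.total_nonneg {r : Rates} (hr : r.Valid) : 0 ≤ r.total := by
  have h1 := sum1_nonneg hr.one_nonneg
  have h2 := sum2_nonneg hr.two_nonneg
  have h3 := sum1_nonneg (hr.anc_nonneg A)
  have h4 := sum1_nonneg (hr.anc_nonneg B)
  have h5 := hr.meas_nonneg
  unfold total
  linarith

theorem Instr.sum_rate_le {r : Rates} (hr : r.Valid) (i : Instr) :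
    ∑ φ, i.rate r φ ≤ r.total := by
  have h : ∀ φ, i.rate r φ = i.weight r φ - if φ = (I, I) then i.weight r (I, I) else 0 := by
    intro φ
    unfold rate
    split_ifs with h
    · subst h; ring
    · ring
  simp only [h, Finset.sum_sub_distrib, Instr.sum_weight]
  rw [Finset.sum_ite_eq' Finset.univ (I, I)]
  simp only [Finset.mem_univ, if_true]
  have h1 := sum1_nonneg hr.one_nonneg
  have h2 := sum2_nonneg hr.two_nonneg
  have h3 := sum1_nonneg (hr.anc_nonneg A)
  have h4 := sum1_nonneg (hr.anc_nonneg B)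
  have h5 := hr.meas_nonneg
  unfold Rates.total
  cases i <;> simp [Instr.weight, weight1, weight2]
  case prep b a => cases a <;> linarith
  all_goals linarith

theorem firstOrder_nonneg {r : Rates} (hr : r.Valid) (p : Program) (g : State → Bool) (s : State) :
    0 ≤ firstOrder r p g s := by
  induction p generalizing s with
  | nil => exact le_rfl
  | cons i p ih =>
    exact add_nonneg (Finset.sum_nonneg fun φ _ =>
      mul_nonneg (Instr.rate_nonneg hr i φ) (ind_nonneg _)) (ih _)

theorem abs_sum_rate_mul_le {r : Rates} (hr : r.Valid) (i : Instr) {f : Fault → ℝ} {c : ℝ}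
    (hf : ∀ φ, |f φ| ≤ c) : |∑ φ, i.rate r φ * f φ| ≤ r.total * c := by
  have hc : 0 ≤ c := (abs_nonneg _).trans (hf (I, I))
  refine (Finset.abs_sum_le_sum_abs _ _).trans ?_
  refine le_trans ?_ (mul_le_mul_of_nonneg_right (i.sum_rate_le hr) hc)
  rw [Finset.sum_mul]
  refine Finset.sum_le_sum fun φ _ => ?_
  rw [abs_mul, abs_of_nonneg (Instr.rate_nonneg hr i φ)]
  exact mul_le_mul_of_nonneg_left (hf φ) (Instr.rate_nonneg hr i φ)

/-- Zeroth order: it is unlikely that the program has any fault. -/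
theorem abs_expect_sub_ideal_le {r : Rates} (hr : r.Valid) (p : Program) (g : State → Bool)
    (s : State) :
    |expect r p (fun a => ind (g a)) s - ind (g (ideal p s))| ≤ p.length * r.total := by
  induction p generalizing s with
  | nil => simp [expect, ideal]
  | cons i p ih =>
    rw [expect, Instr.sum_weight_mul, ideal, add_sub_right_comm]
    refine (abs_add_le _ _).trans ?_
    have h1 := ih (i.idealStep s)
    have h2 : |∑ φ, i.rate r φ * (expect r p (fun a => ind (g a)) (i.step φ s) -
        expect r p (fun a => ind (g a)) (i.step (I, I) s))| ≤ r.total * 1 := by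
      refine abs_sum_rate_mul_le hr i fun φ => ?_
      rw [abs_le]
      have := expect_le_one hr p (fun a => ind_le_one (g a)) (i.step φ s)
      have := expect_le_one hr p (fun a => ind_le_one (g a)) (i.step (I, I) s)
      have := expect_nonneg hr p (fun a => ind_nonneg (g a)) (i.step φ s)
      have := expect_nonneg hr p (fun a => ind_nonneg (g a)) (i.step (I, I) s)
      constructor <;> linarith
    push_cast [List.length_cons]
    linarith

/-- If a test is false in the absence of faults, then its probability is the first-order
expression, up to terms of second order: two faults have to coincide. -/
theorem abs_expect_sub_firstOrder_le {r : Rates} (hr : r.Valid) (p : Program) (g : State → Bool)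
    (s : State) (hg : g (ideal p s) = false) :
    |expect r p (fun a => ind (g a)) s - firstOrder r p g s| ≤
      2 * p.length ^ 2 * r.total ^ 2 := by
  induction p generalizing s with
  | nil => simp [expect, firstOrder, show g s = false from hg, ind_false]
  | cons i p ih =>
    have h1 := ih (i.idealStep s) hg
    have h0 : ind (g (ideal p (i.step (I, I) s))) = 0 := by
      rw [show g (ideal p (i.step (I, I) s)) = false from hg, ind_false]
    rw [expect, Instr.sum_weight_mul, firstOrder]
    set E : State → ℝ := expect r p (fun a => ind (g a)) with hE
    have hE' : ∀ φ, |E (i.step φ s) - ind (g (ideal p (i.step φ s)))| ≤ p.length * r.total :=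
      fun φ => abs_expect_sub_ideal_le hr p g _
    have h2 : |∑ φ, i.rate r φ * ((E (i.step φ s) - ind (g (ideal p (i.step φ s)))) -
        (E (i.step (I, I) s) - ind (g (ideal p (i.step (I, I) s)))))| ≤
        r.total * (p.length * r.total + p.length * r.total) :=
      abs_sum_rate_mul_le hr i fun φ =>
        (abs_sub _ _).trans (add_le_add (hE' φ) (hE' (I, I)))
    have h3 : E (i.step (I, I) s) + ∑ φ, i.rate r φ * (E (i.step φ s) - E (i.step (I, I) s)) -
        (∑ φ, i.rate r φ * ind (g (ideal p (i.step φ s))) + firstOrder r p g (i.idealStep s)) =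
        (E (i.idealStep s) - firstOrder r p g (i.idealStep s)) +
        ∑ φ, i.rate r φ * ((E (i.step φ s) - ind (g (ideal p (i.step φ s)))) -
        (E (i.step (I, I) s) - ind (g (ideal p (i.step (I, I) s))))) := by
      rw [h0]
      simp only [mul_sub, Finset.sum_sub_distrib, sub_zero]
      ring
    rw [h3]
    refine (abs_add_le _ _).trans ((add_le_add h1 h2).trans ?_)
    have hS := hr.total_nonneg
    push_cast [List.length_cons]
    nlinarith [mul_nonneg (Nat.cast_nonneg (α := ℝ) p.length) (sq_nonneg r.total),
      sq_nonneg r.total]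

/-! ### Linear programs -/

/-- Superposition of two patterns of unknown errors. -/
def State.add (s s' : State) : State :=
  ⟨fun b => s.x b ^^ s'.x b, fun b => s.z b ^^ s'.z b, List.zipWith xor s.out s'.out⟩

/-- A strand without errors on which `n` measurements have been made. -/
def State.zero (n : ℕ) : State := ⟨fun _ => false, fun _ => false, List.replicate n false⟩

theorem zipWith_xor_replicate (o : List Bool) :
    List.zipWith xor o (List.replicate o.length false) = o := by
  induction o with
  | nil => rfl
  | cons a o ih => simp [List.replicate_succ, ih]

theorem State.add_zero (s : State) : s.add (State.zero s.out.length) = s := by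
  cases s
  simp [State.add, State.zero, zipWith_xor_replicate]

/-- The decision how to update the record of known errors is additive in the measurement errors. -/
def AdditiveRule (f : List Bool → Bool) : Prop :=
  ∀ o o' : List Bool, o.length = o'.length → f (List.zipWith xor o o') = (f o ^^ f o')

/-- Errors propagate additively: updates of the record use additive rules. -/
def Instr.Linear : Instr → Prop
  | .fixX _ f => AdditiveRule f
  | .fixZ _ f => AdditiveRule f
  | _ => True

theorem additiveRule_lastOne : AdditiveRule lastOne := by
  intro o o' h
  cases o <;> cases o' <;> simp_all [lastOne]

theorem AdditiveRule.replicate {f : List Bool → Bool} (h : AdditiveRule f) (n : ℕ) :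
    f (List.replicate n false) = false := by
  have := h (List.replicate n false) (List.replicate n false) rfl
  have h' := zipWith_xor_replicate (List.replicate n false)
  rw [List.length_replicate] at h'
  rw [h'] at this
  simpa using this

theorem State.mk_congr {x x' z z' : ℕ → Bool} {o o' : List Bool} (hx : ∀ b, x b = x' b)
    (hz : ∀ b, z b = z' b) (ho : o = o') : State.mk x z o = State.mk x' z' o' := by
  rw [funext hx, funext hz, ho]

/-- The number of results added by an operation. -/
def Instr.outs : Instr → ℕ
  | .meas _ => 1
  | _ => 0

theorem Instr.length_step (i : Instr) (φ : Fault) (s : State) :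
    (i.step φ s).out.length = s.out.length + i.outs := by
  cases i <;> simp [Instr.step, State.hit, Instr.outs]

theorem Instr.step_add {i : Instr} (hi : i.Linear) (φ : Fault) (s s' : State)
    (h : s.out.length = s'.out.length) :
    i.step φ (s.add s') = (i.idealStep s).add (i.step φ s') := by
  cases i
  case fixX b f =>
    refine State.mk_congr (fun a => ?_) (fun a => rfl) rfl
    simp only [State.add, Instr.step, Function.update_apply, hi _ _ h]
    split_ifs <;> simp [Bool.xor_comm, Bool.xor_left_comm]
  case fixZ b f =>
    refine State.mk_congr (fun a => rfl) (fun a => ?_) rfl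
    simp only [State.add, Instr.step, Function.update_apply, hi _ _ h]
    split_ifs <;> simp [Bool.xor_comm, Bool.xor_left_comm]
  case meas b =>
    refine State.mk_congr (fun a => rfl) (fun a => rfl) ?_
    simp [State.add, Instr.step, Pauli.xbit, Bool.xor_comm]
  case swap b b' =>
    exact State.mk_congr (fun a => rfl) (fun a => rfl) rfl
  case prep b a =>
    refine State.mk_congr (fun a => ?_) (fun a => ?_) rfl <;>
    · simp only [State.add, Instr.step, Function.update_apply, Pauli.xbit, Pauli.zbit]
      split_ifs <;> simp
  case had b =>
    refine State.mk_congr (fun a => ?_) (fun a => ?_) rfl <;>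
    · simp only [State.add, Instr.step, State.hit, Function.update_apply, Pauli.xbit, Pauli.zbit]
      split_ifs <;> simp [Bool.xor_comm]
  case phase b =>
    refine State.mk_congr (fun a => ?_) (fun a => ?_) rfl <;>
    · simp only [State.add, Instr.step, State.hit, Function.update_apply, Pauli.xbit, Pauli.zbit]
      split_ifs <;> simp [Bool.xor_comm, Bool.xor_left_comm]
  case cx c t =>
    refine State.mk_congr (fun a => ?_) (fun a => ?_) rfl <;>
    · simp only [State.add, Instr.step, State.hit, Function.update_apply, Pauli.xbit, Pauli.zbit]
      split_ifs <;> simp [Bool.xor_comm, Bool.xor_left_comm]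

theorem Instr.idealStep_zero {i : Instr} (hi : i.Linear) (n : ℕ) :
    i.idealStep (State.zero n) = State.zero (n + i.outs) := by
  cases i
  case fixX b f =>
    refine State.mk_congr (fun a => ?_) (fun a => rfl) rfl
    simp only [State.zero, Function.update_apply, AdditiveRule.replicate hi]
    split_ifs <;> rfl
  case fixZ b f =>
    refine State.mk_congr (fun a => rfl) (fun a => ?_) rfl
    simp only [State.zero, Function.update_apply, AdditiveRule.replicate hi]
    split_ifs <;> rfl
  case meas b => exact State.mk_congr (fun a => rfl) (fun a => rfl) rfl
  case swap b b' => exact State.mk_congr (fun a => rfl) (fun a => rfl) rfl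
  all_goals
    refine State.mk_congr (fun a => ?_) (fun a => ?_) rfl <;>
    · simp only [State.zero, State.hit, Function.update_apply, Pauli.xbit, Pauli.zbit]
      split_ifs <;> rfl

theorem ideal_add {p : Program} (hp : ∀ i ∈ p, i.Linear) (s s' : State)
    (h : s.out.length = s'.out.length) :
    ideal p (s.add s') = (ideal p s).add (ideal p s') := by
  induction p generalizing s s' with
  | nil => rfl
  | cons i p ih =>
    rw [ideal, ideal, ideal, Instr.idealStep, Instr.step_add (hp i (by simp)) _ _ _ h]
    exact ih (fun j hj => hp j (by simp [hj])) _ _ (by simp [Instr.length_step, h])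

theorem length_ideal (p : Program) (s s' : State) (h : s.out.length = s'.out.length) :
    (ideal p s).out.length = (ideal p s').out.length := by
  induction p generalizing s s' with
  | nil => exact h
  | cons i p ih => exact ih _ _ (by simp [Instr.length_step, h])

/-- A test that is additive in the errors. -/
def AdditiveTest (g : State → Bool) : Prop :=
  ∀ s s' : State, s.out.length = s'.out.length → g (s.add s') = (g s ^^ g s')

theorem ind_xor_le (a b : Bool) : ind (a ^^ b) ≤ ind a + ind b := by
  cases a <;> cases b <;> simp [ind]

/-- Union bound: an additive test of a linear program is true only if the initial errors or some
single fault make it true.  There are no terms of second order. -/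
theorem expect_le_firstOrder_of_linear {r : Rates} (hr : r.Valid) {p : Program}
    (hp : ∀ i ∈ p, i.Linear) {g : State → Bool} (hg : AdditiveTest g) (s : State) :
    expect r p (fun a => ind (g a)) s ≤
      ind (g (ideal p s)) + firstOrder r p g (State.zero s.out.length) := by
  induction p generalizing s with
  | nil => simp [expect, ideal, firstOrder]
  | cons i p ih =>
    have hi := hp i (by simp)
    have hp' : ∀ i ∈ p, i.Linear := fun j hj => hp j (by simp [hj])
    set G : ℝ := ind (g (ideal p (i.idealStep s))) with hG
    set R : ℝ := firstOrder r p g (State.zero (s.out.length + i.outs)) with hR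
    set f : Fault → ℝ := fun φ =>
      if φ = (I, I) then 0 else ind (g (ideal p (i.step φ (State.zero s.out.length)))) with hf
    have hstep : ∀ φ, expect r p (fun a => ind (g a)) (i.step φ s) ≤ G + R + f φ := by
      intro φ
      have h1 := ih hp' (i.step φ s)
      rw [Instr.length_step] at h1
      by_cases hφ : φ = (I, I)
      · subst hφ
        simpa [hf] using h1
      · have h2 : i.step φ s = (i.idealStep s).add (i.step φ (State.zero s.out.length)) := by
          conv_lhs => rw [← s.add_zero]
          exact Instr.step_add hi _ _ _ (by simp [State.zero])
        have h3 : g (ideal p (i.step φ s)) = (g (ideal p (i.idealStep s)) ^^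
            g (ideal p (i.step φ (State.zero s.out.length)))) := by
          have hl : (i.idealStep s).out.length =
              (i.step φ (State.zero s.out.length)).out.length := by
            simp [Instr.length_step, State.zero]
          rw [h2, ideal_add hp' _ _ hl]
          exact hg _ _ (length_ideal _ _ _ hl)
        rw [h3] at h1
        refine h1.trans ?_
        have := ind_xor_le (g (ideal p (i.idealStep s)))
          (g (ideal p (i.step φ (State.zero s.out.length))))
        simp only [hf, if_neg hφ]
        linarith
    calc expect r (i :: p) (fun a => ind (g a)) s
        ≤ ∑ φ, i.weight r φ * (G + R + f φ) :=
          Finset.sum_le_sum fun φ _ =>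
            mul_le_mul_of_nonneg_left (hstep φ) (Instr.weight_nonneg hr i φ)
      _ = G + R + ∑ φ, i.rate r φ * ind (g (ideal p (i.step φ (State.zero s.out.length)))) := by
          simp only [mul_add, Finset.sum_add_distrib, ← Finset.sum_mul, Instr.sum_weight, one_mul]
          congr 1
          refine Finset.sum_congr rfl fun φ _ => ?_
          simp only [hf, Instr.rate]
          split_ifs <;> ring
      _ = _ := by
          rw [ideal, firstOrder, Instr.idealStep_zero hi]
          ring

/-! ### Relabelling, locality and history -/

theorem measCount_cons (i : Instr) (p : Program) : measCount (i :: p) = i.outs + measCount p := by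
  cases i <;> simp [measCount, Instr.outs, add_comm]

theorem measCount_append (p p' : Program) : measCount (p ++ p') = measCount p + measCount p' := by
  simp [measCount, List.countP_append]

/-- Along a program of a given number of measurements, only states with the corresponding number of
results matter. -/
theorem expect_mono_of_length {r : Rates} (hr : r.Valid) (p : Program) {g h : State → ℝ} (s : State)
    (H : ∀ a, a.out.length = s.out.length + measCount p → g a ≤ h a) :
    expect r p g s ≤ expect r p h s := by
  induction p generalizing s with
  | nil => exact H s (by simp [measCount])
  | cons i p ih =>
    refine Finset.sum_le_sum fun φ _ => mul_le_mul_of_nonneg_left (ih _ fun a ha => H a ?_)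
      (Instr.weight_nonneg hr i φ)
    rw [ha, Instr.length_step, measCount_cons, add_assoc]

theorem Instr.errorAt_step (i : Instr) (φ : Fault) (s : State) {L : ℕ} (hL : L < s.out.length) :
    (i.step φ s).errorAt L = s.errorAt L := by
  cases i <;> simp [Instr.step, State.hit, State.errorAt]
  rw [List.getElem?_append_left (by simpa using hL)]

/-- Results that have been obtained do not change any more. -/
theorem expect_errorAt_of_lt (r : Rates) (p : Program) (s : State) {L : ℕ}
    (hL : L < s.out.length) :
    expect r p (fun a => ind (a.errorAt L)) s = ind (s.errorAt L) := by
  induction p generalizing s with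
  | nil => rfl
  | cons i p ih =>
    have : ∀ φ, expect r p (fun a => ind (a.errorAt L)) (i.step φ s) = ind (s.errorAt L) := by
      intro φ
      rw [ih _ (by rw [Instr.length_step]; omega), Instr.errorAt_step i φ s hL]
    simp only [expect, this, ← Finset.sum_mul, Instr.sum_weight, one_mul]

/-- The blocks an operation may change. -/
def Instr.writes : Instr → List ℕ
  | .prep b _ => [b]
  | .had b => [b]
  | .phase b => [b]
  | .cx c t => [c, t]
  | .meas _ => []
  | .fixX b _ => [b]
  | .fixZ b _ => [b]
  | .swap b b' => [b, b']

theorem Instr.step_of_notMem (i : Instr) (φ : Fault) (s : State) {b : ℕ} (hb : b ∉ i.writes) :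
    (i.step φ s).x b = s.x b ∧ (i.step φ s).z b = s.z b := by
  cases i <;> simp_all [Instr.step, State.hit, Instr.writes, Function.update_apply,
    Equiv.swap_apply_of_ne_of_ne]

/-- The errors of a block that the program does not change can be treated as constants. -/
theorem expect_of_untouched (r : Rates) (p : Program) {b : ℕ} (hb : ∀ i ∈ p, b ∉ i.writes)
    (H : Bool → Bool → State → ℝ) (s : State) :
    expect r p (fun a => H (a.x b) (a.z b) a) s = expect r p (H (s.x b) (s.z b)) s := by
  induction p generalizing s with
  | nil => rfl
  | cons i p ih =>
    refine Finset.sum_congr rfl fun φ _ => ?_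
    have h := i.step_of_notMem φ s (hb i (by simp))
    rw [ih (fun j hj => hb j (by simp [hj])), h.1, h.2]

/-- Relabelling of the blocks. -/
def Instr.rename (σ : ℕ → ℕ) : Instr → Instr
  | .prep b a => .prep (σ b) a
  | .had b => .had (σ b)
  | .phase b => .phase (σ b)
  | .cx c t => .cx (σ c) (σ t)
  | .meas b => .meas (σ b)
  | .fixX b f => .fixX (σ b) f
  | .fixZ b f => .fixZ (σ b) f
  | .swap b b' => .swap (σ b) (σ b')

/-- Relabelling of the blocks of a program. -/
def rename (σ : ℕ → ℕ) (p : Program) : Program := p.map (Instr.rename σ)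

theorem measCount_rename (σ : ℕ → ℕ) (p : Program) : measCount (rename σ p) = measCount p := by
  induction p with
  | nil => rfl
  | cons i p ih =>
    rw [rename, List.map_cons, measCount_cons, measCount_cons]
    rw [rename] at ih
    rw [ih]
    cases i <;> rfl

theorem Instr.weight_rename (r : Rates) (σ : ℕ → ℕ) (i : Instr) (φ : Fault) :
    (i.rename σ).weight r φ = i.weight r φ := by cases i <;> rfl

/-- An update rule that looks at the last `k` results only. -/
def ReadsLast (k : ℕ) (f : List Bool → Bool) : Prop :=
  ∀ o v : List Bool, k ≤ o.length → f (o ++ v) = f o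

theorem readsLast_lastOne {k : ℕ} (hk : 1 ≤ k) : ReadsLast k lastOne := by
  intro o v h
  match o with
  | [] => simp at h; omega
  | a :: o => rfl

theorem readsLast_lastBoth {k : ℕ} (hk : 2 ≤ k) : ReadsLast k lastBoth := by
  intro o v h
  match o with
  | [] => simp at h; omega
  | [_] => simp at h; omega
  | a :: b :: o => rfl

/-- A program that reads only blocks which belong to `S` or have been prepared by the program, and
only results of its own measurements, `k` of which have been made before.  In the end the blocks
`T` have to be among those that it could read. -/
def LocalTo (T : List ℕ) : Program → List ℕ → ℕ → Prop
  | [], S, _ => ∀ b ∈ T, b ∈ S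
  | .prep b _ :: p, S, k => LocalTo T p (b :: S) k
  | .had b :: p, S, k => b ∈ S ∧ LocalTo T p S k
  | .phase b :: p, S, k => b ∈ S ∧ LocalTo T p S k
  | .cx c t :: p, S, k => c ∈ S ∧ t ∈ S ∧ LocalTo T p S k
  | .meas b :: p, S, k => b ∈ S ∧ LocalTo T p S (k + 1)
  | .fixX b f :: p, S, k => b ∈ S ∧ ReadsLast k f ∧ LocalTo T p S k
  | .fixZ b f :: p, S, k => b ∈ S ∧ ReadsLast k f ∧ LocalTo T p S k
  | .swap b b' :: p, S, k => b ∈ S ∧ b' ∈ S ∧ LocalTo T p S k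

/-- The state `s` agrees, on the blocks `S` relabelled by `σ`, with the state `s'`, which has
forgotten the earlier results `v`. -/
structure Sim (σ : ℕ → ℕ) (S : List ℕ) (v : List Bool) (s s' : State) : Prop where
  x : ∀ b ∈ S, s.x (σ b) = s'.x b
  z : ∀ b ∈ S, s.z (σ b) = s'.z b
  out : s.out = s'.out ++ v

theorem Sim.mono {σ : ℕ → ℕ} {S S' : List ℕ} {v : List Bool} {s s' : State} (h : Sim σ S v s s')
    (hS : ∀ b ∈ S', b ∈ S) : Sim σ S' v s s' :=
  ⟨fun b hb => h.x b (hS b hb), fun b hb => h.z b (hS b hb), h.out⟩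

theorem Sim.hit {σ : ℕ → ℕ} (hσ : Function.Injective σ) {S : List ℕ} {v : List Bool}
    {s s' : State} (h : Sim σ S v s s') (b : ℕ) (P : Pauli) (hb : b ∈ S) :
    Sim σ S v (s.hit (σ b) P) (s'.hit b P) := by
  refine ⟨fun a ha => ?_, fun a ha => ?_, h.out⟩ <;>
  simp only [State.hit, Function.update_apply, hσ.eq_iff, h.x a ha, h.z a ha, h.x b hb, h.z b hb]

/-- The expected value of a local test of a local program depends neither on the labels of the
blocks, nor on the errors of other blocks, nor on the results of earlier measurements. -/
theorem expect_rename (r : Rates) {σ : ℕ → ℕ} (hσ : Function.Injective σ) (p : Program)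
    {T S : List ℕ} {v : List Bool} {s s' : State} (hp : LocalTo T p S s'.out.length)
    (hs : Sim σ S v s s') {g g' : State → ℝ} (hg : ∀ a a', Sim σ T v a a' → g a = g' a') :
    expect r (rename σ p) g s = expect r p g' s' := by
  induction p generalizing S s s' with
  | nil => exact hg _ _ (hs.mono hp)
  | cons i p ih =>
    refine Finset.sum_congr rfl fun φ _ => ?_
    rw [Instr.weight_rename]
    congr 1
    change expect r (rename σ p) g _ = _
    have hx := hs.x
    have hz := hs.z
    cases i with
    | prep b a =>
      refine ih (S := b :: S) hp ⟨fun c hc => ?_, fun c hc => ?_, hs.out⟩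
      · simp only [Instr.step, Instr.rename, Function.update_apply, hσ.eq_iff]
        rcases List.mem_cons.1 hc with rfl | hc
        · simp
        · rw [hx c hc]
      · simp only [Instr.step, Instr.rename, Function.update_apply, hσ.eq_iff]
        rcases List.mem_cons.1 hc with rfl | hc
        · simp
        · rw [hz c hc]
    | had b =>
      refine ih (S := S) hp.2 (Sim.hit hσ
        (s := ⟨Function.update s.x (σ b) (s.z (σ b)), Function.update s.z (σ b) (s.x (σ b)), s.out⟩)
        (s' := ⟨Function.update s'.x b (s'.z b), Function.update s'.z b (s'.x b), s'.out⟩)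
        ⟨fun c hc => ?_, fun c hc => ?_, hs.out⟩ b φ.1 hp.1) <;>
      simp only [Function.update_apply, hσ.eq_iff, hx b hp.1, hz b hp.1, hx c hc, hz c hc]
    | phase b =>
      refine ih (S := S) hp.2 (Sim.hit hσ
        (s := ⟨s.x, Function.update s.z (σ b) (s.z (σ b) ^^ s.x (σ b)), s.out⟩)
        (s' := ⟨s'.x, Function.update s'.z b (s'.z b ^^ s'.x b), s'.out⟩)
        ⟨hx, fun c hc => ?_, hs.out⟩ b φ.1 hp.1)
      simp only [Function.update_apply, hσ.eq_iff, hx b hp.1, hz b hp.1, hz c hc]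
    | cx c t =>
      refine ih (S := S) hp.2.2 (Sim.hit hσ (Sim.hit hσ
        (s := ⟨Function.update s.x (σ t) (s.x (σ t) ^^ s.x (σ c)),
          Function.update s.z (σ c) (s.z (σ c) ^^ s.z (σ t)), s.out⟩)
        (s' := ⟨Function.update s'.x t (s'.x t ^^ s'.x c),
          Function.update s'.z c (s'.z c ^^ s'.z t), s'.out⟩)
        ⟨fun a ha => ?_, fun a ha => ?_, hs.out⟩ c φ.1 hp.1) t φ.2 hp.2.1) <;>
      simp only [Function.update_apply, hσ.eq_iff, hx c hp.1, hz c hp.1, hx t hp.2.1, hz t hp.2.1,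
        hx a ha, hz a ha]
    | meas b =>
      refine ih (S := S) hp.2 ⟨hx, hz, ?_⟩
      simp [Instr.step, Instr.rename, hx b hp.1, hs.out]
    | fixX b f =>
      refine ih (S := S) hp.2.2 ⟨fun c hc => ?_, hz, hs.out⟩
      simp only [Instr.step, Instr.rename, Function.update_apply, hσ.eq_iff, hx b hp.1, hx c hc,
        hs.out, hp.2.1 s'.out v le_rfl]
    | fixZ b f =>
      refine ih (S := S) hp.2.2 ⟨hx, fun c hc => ?_, hs.out⟩
      simp only [Instr.step, Instr.rename, Function.update_apply, hσ.eq_iff, hz b hp.1, hz c hc,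
        hs.out, hp.2.1 s'.out v le_rfl]
    | swap b b' =>
      have hmem : ∀ c ∈ S, Equiv.swap b b' c ∈ S := by
        intro c hc
        rw [Equiv.swap_apply_def]
        split_ifs
        · exact hp.2.1
        · exact hp.1
        · exact hc
      refine ih (S := S) hp.2.2 ⟨fun c hc => ?_, fun c hc => ?_, hs.out⟩
      · simp only [Instr.step, Instr.rename, Function.comp_apply, ← hσ.map_swap]
        exact hx _ (hmem c hc)
      · simp only [Instr.step, Instr.rename, Function.comp_apply, ← hσ.map_swap]
        exact hz _ (hmem c hc)

theorem Sim.errorAt {σ : ℕ → ℕ} {S : List ℕ} {v : List Bool} {a a' : State} (h : Sim σ S v a a')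
    (j : ℕ) : a.errorAt (v.length + j) = a'.errorAt j := by
  unfold State.errorAt
  rw [h.out, List.reverse_append, List.getD_append_right _ _ _ _ (by simp)]
  simp

theorem getD_zipWith_xor {o o' : List Bool} (h : o.length = o'.length) (j : ℕ) :
    (List.zipWith xor o o').getD j false = (o.getD j false ^^ o'.getD j false) := by
  induction o generalizing o' j with
  | nil =>
    cases o' with
    | nil => simp
    | cons => simp at h
  | cons a o ih =>
    cases o' with
    | nil => simp at h
    | cons b o' =>
      cases j with
      | zero => simp
      | succ j => simpa using ih (by simpa using h) j

theorem additiveTest_errorAt (j : ℕ) : AdditiveTest fun s => s.errorAt j := by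
  intro s s' h
  simp only [State.errorAt, State.add]
  rw [← getD_zipWith_xor (by simpa using h), List.reverse_zipWith h]

/-! ### Coefficients of the first-order expressions -/

/-- The individual error rates of the model. -/
inductive RateVar where
  | one (P : Pauli)
  | two (P Q : Pauli)
  | meas
  | anc (a : Anc) (P : Pauli)

/-- The value of an error rate. -/
def RateVar.val (r : Rates) : RateVar → ℝ
  | .one P => r.one P
  | .two P Q => r.two P Q
  | .meas => r.meas
  | .anc a P => r.anc a P

/-- All error rates; the values at the identity are not among them. -/
def rateVars : List RateVar :=
  [.one X, .one Y, .one Z,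
   .two I X, .two I Y, .two I Z,
   .two X I, .two X X, .two X Y, .two X Z,
   .two Y I, .two Y X, .two Y Y, .two Y Z,
   .two Z I, .two Z X, .two Z Y, .two Z Z,
   .meas,
   .anc A X, .anc A Y, .anc A Z,
   .anc B X, .anc B Y, .anc B Z]

theorem RateVar.val_nonneg {r : Rates} (hr : r.Valid) : ∀ v ∈ rateVars, 0 ≤ v.val r := by
  have h1 := hr.one_nonneg
  have h2 := hr.two_nonneg
  have h3 := hr.meas_nonneg
  have h4 := hr.anc_nonneg
  simp only [rateVars, List.forall_mem_cons, RateVar.val]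
  simp_all

/-- The linear expression in the error rates with the given coefficients. -/
def rateSum (r : Rates) (f : RateVar → ℕ) : ℝ := (rateVars.map fun v => v.val r * f v).sum

theorem rateSum_mono {r : Rates} (hr : r.Valid) {f g : RateVar → ℕ}
    (h : ∀ v ∈ rateVars, f v ≤ g v) : rateSum r f ≤ rateSum r g :=
  List.sum_le_sum fun v hv => mul_le_mul_of_nonneg_left (by exact_mod_cast h v hv)
    (RateVar.val_nonneg hr v hv)

theorem rateSum_congr (r : Rates) {f g : RateVar → ℕ} (h : ∀ v ∈ rateVars, f v = g v) :
    rateSum r f = rateSum r g := by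
  unfold rateSum
  rw [List.map_congr_left fun v hv => by rw [h v hv]]

theorem rateSum_add (r : Rates) (f g : RateVar → ℕ) :
    rateSum r (fun v => f v + g v) = rateSum r f + rateSum r g := by
  unfold rateSum
  rw [← List.sum_map_add]
  simp [mul_add]

theorem rateSum_zero (r : Rates) : rateSum r (fun _ => 0) = 0 := by
  simp [rateSum]

/-- The fault of an operation that has the given rate. -/
def Instr.faultOf : Instr → RateVar → Option Fault
  | .prep _ A, .anc A P => some (P, I)
  | .prep _ B, .anc B P => some (P, I)
  | .had _, .one P => some (P, I)
  | .phase _, .one P => some (P, I)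
  | .cx _ _, .two P Q => some (P, Q)
  | .meas _, .meas => some (X, I)
  | _, _ => none

theorem Instr.sum_rate_mul (r : Rates) (i : Instr) (f : Fault → ℝ) :
    ∑ φ, i.rate r φ * f φ =
      (rateVars.map fun v => v.val r * (i.faultOf v).elim 0 f).sum := by
  cases i
  case prep b a =>
    cases a <;>
    simp [rateVars, Fintype.sum_prod_type, sum_pauli, Instr.rate, Instr.weight, Instr.faultOf,
      weight1, RateVar.val] <;> ring
  all_goals
    simp [rateVars, Fintype.sum_prod_type, sum_pauli, Instr.rate, Instr.weight, Instr.faultOf,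
      weight1, weight2, RateVar.val]
  all_goals try ring

/-- The number of single faults of the given rate for which the test `g` is true in the end. -/
def coef : Program → (State → Bool) → State → RateVar → ℕ
  | [], _, _, _ => 0
  | i :: p, g, s, v => ((i.faultOf v).elim 0 fun φ => (g (ideal p (i.step φ s))).toNat) +
      coef p g (i.idealStep s) v

theorem ind_eq_toNat (b : Bool) : ind b = (b.toNat : ℝ) := by cases b <;> simp [ind]

theorem firstOrder_eq_rateSum (r : Rates) (p : Program) (g : State → Bool) (s : State) :
    firstOrder r p g s = rateSum r (coef p g s) := by
  induction p generalizing s with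
  | nil => simp [firstOrder, coef, rateSum]
  | cons i p ih =>
    rw [firstOrder, ih, Instr.sum_rate_mul r i fun φ => ind (g (ideal p (i.step φ s)))]
    have : coef (i :: p) g s = fun v =>
        ((i.faultOf v).elim 0 fun φ => (g (ideal p (i.step φ s))).toNat) +
          coef p g (i.idealStep s) v := rfl
    rw [this, rateSum_add]
    congr 2
    refine List.map_congr_left fun v _ => ?_
    rcases h : i.faultOf v with _ | φ <;> simp [ind_eq_toNat, h]

/-- Position of an error rate in `rateVars`. -/
def RateVar.index : RateVar → ℕ
  | .one P => rank P - 1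
  | .two P Q => 4 * rank P + rank Q + 2
  | .meas => 18
  | .anc A P => rank P + 18
  | .anc B P => rank P + 21
where
  /-- Number of a Pauli operator. -/
  rank : Pauli → ℕ
    | .I => 0 | .X => 1 | .Y => 2 | .Z => 3

/-- The coefficients of the linear expressions of which `gateTable` is the maximum, in the order of
`rateVars`. -/
def tableRows : Procedure → Gate → List (List ℕ)
  | .singleSteane, .idle =>
    [[2, 2, 0, 0, 1, 1, 0, 0, 1, 1, 4, 4, 3, 3, 4, 4, 3, 3, 2, 0, 2, 2, 0, 2, 2],
     [0, 0, 0, 4, 4, 0, 1, 3, 3, 1, 1, 3, 3, 1, 0, 4, 4, 0, 2, 2, 2, 0, 2, 2, 0]]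
  | .singleSteane, .had =>
    [[2, 2, 0, 1, 2, 1, 0, 1, 2, 1, 2, 3, 2, 1, 2, 3, 2, 1, 2, 1, 2, 1, 0, 1, 1],
     [1, 2, 1, 1, 1, 0, 1, 0, 0, 1, 3, 2, 2, 3, 2, 3, 3, 2, 2, 1, 2, 1, 0, 1, 1]]
  | .singleSteane, .cx =>
    [[3, 3, 0, 0, 2, 2, 0, 0, 2, 2, 5, 5, 3, 3, 5, 5, 3, 3, 3, 0, 1, 1, 0, 3, 3],
     [0, 0, 0, 5, 5, 0, 2, 3, 3, 2, 2, 3, 3, 2, 0, 5, 5, 0, 3, 3, 3, 0, 1, 1, 0]]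
  | .singleSteane, .pt =>
    [[0, 0, 0, 3, 3, 0, 1, 2, 2, 1, 1, 2, 2, 1, 0, 3, 3, 0, 2, 1, 1, 0, 2, 2, 0],
     [2, 2, 0, 0, 1, 1, 0, 0, 1, 1, 3, 3, 2, 2, 3, 3, 2, 2, 2, 0, 0, 0, 0, 3, 3]]
  | .doubleSteane, .idle =>
    [[1, 1, 0, 0, 3, 3, 0, 0, 3, 3, 5, 5, 7, 7, 5, 5, 7, 7, 1, 0, 4, 4, 0, 1, 1],
     [0, 0, 0, 5, 5, 0, 3, 7, 7, 3, 3, 7, 7, 3, 0, 5, 5, 0, 1, 1, 1, 0, 4, 4, 0]]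
  | .doubleSteane, .had =>
    [[1, 1, 0, 1, 3, 2, 1, 2, 4, 3, 3, 4, 5, 4, 2, 3, 4, 3, 1, 1, 3, 2, 0, 0, 0],
     [1, 2, 1, 0, 1, 1, 2, 1, 2, 3, 5, 4, 5, 6, 3, 3, 4, 4, 1, 0, 2, 2, 0, 1, 1]]
  | .doubleSteane, .cx =>
    [[1, 1, 0, 0, 5, 5, 0, 0, 5, 5, 4, 4, 7, 7, 4, 4, 7, 7, 1, 0, 2, 2, 0, 1, 1],
     [0, 0, 0, 4, 4, 0, 5, 7, 7, 5, 5, 7, 7, 5, 0, 4, 4, 0, 1, 1, 1, 0, 2, 2, 0]]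
  | .doubleSteane, .pt =>
    [[0, 0, 0, 3, 3, 0, 2, 4, 4, 2, 2, 4, 4, 2, 0, 3, 3, 0, 1, 0, 0, 0, 3, 3, 0],
     [1, 1, 0, 0, 3, 3, 0, 0, 3, 3, 2, 2, 4, 4, 2, 2, 4, 4, 1, 0, 0, 0, 0, 2, 2],
     [0, 0, 0, 3, 3, 0, 1, 4, 4, 1, 1, 4, 4, 1, 0, 3, 3, 0, 1, 1, 1, 0, 3, 3, 0]]
  | .knill, .idle | .knill, .pt =>
    [[1, 1, 0, 0, 0, 0, 0, 0, 0, 0, 1, 1, 1, 1, 1, 1, 1, 1, 1, 0, 1, 1, 0, 1, 1],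
     [0, 0, 0, 1, 1, 0, 0, 1, 1, 0, 0, 1, 1, 0, 0, 1, 1, 0, 1, 1, 1, 0, 1, 1, 0]]
  | .knill, .had =>
    [[1, 1, 0, 1, 1, 0, 0, 1, 1, 0, 0, 1, 1, 0, 0, 1, 1, 0, 1, 0, 0, 0, 1, 2, 1],
     [1, 2, 1, 0, 0, 0, 0, 0, 0, 0, 1, 1, 1, 1, 1, 1, 1, 1, 1, 0, 0, 0, 1, 2, 1]]
  | .knill, .cx =>
    [[1, 1, 0, 0, 0, 0, 0, 0, 0, 0, 2, 2, 2, 2, 2, 2, 2, 2, 1, 0, 2, 2, 0, 1, 1],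
     [0, 0, 0, 1, 1, 0, 1, 2, 2, 1, 1, 2, 2, 1, 0, 1, 1, 0, 1, 1, 1, 0, 1, 1, 0],
     [0, 0, 0, 2, 2, 0, 0, 2, 2, 0, 0, 2, 2, 0, 0, 2, 2, 0, 1, 1, 1, 0, 2, 2, 0],
     [1, 1, 0, 0, 1, 1, 0, 0, 1, 1, 1, 1, 2, 2, 1, 1, 2, 2, 1, 0, 1, 1, 0, 1, 1]]

/-- Read a list of coefficients as a function. -/
def rowFun (l : List ℕ) (v : RateVar) : ℕ := l.getD v.index 0

/-- The largest of the linear expressions with the given coefficients. -/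
def maxRows (r : Rates) : List (List ℕ) → ℝ
  | [] => 0
  | [a] => rateSum r (rowFun a)
  | a :: l => max (rateSum r (rowFun a)) (maxRows r l)

theorem rateSum_le_maxRows (r : Rates) {l : List (List ℕ)} {a : List ℕ} (ha : a ∈ l) :
    rateSum r (rowFun a) ≤ maxRows r l := by
  induction l with
  | nil => simp at ha
  | cons b l ih =>
    cases l with
    | nil =>
      rw [List.mem_singleton.1 ha]
      exact le_rfl
    | cons c l =>
      rcases List.mem_cons.1 ha with rfl | h
      · exact le_max_left _ _
      · exact (ih h).trans (le_max_right _ _)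

theorem exists_maxRows_eq (r : Rates) {l : List (List ℕ)} (hl : l ≠ []) :
    ∃ a ∈ l, maxRows r l = rateSum r (rowFun a) := by
  induction l with
  | nil => exact absurd rfl hl
  | cons b l ih =>
    cases l with
    | nil => exact ⟨b, by simp, rfl⟩
    | cons c l =>
      obtain ⟨a, ha, h⟩ := ih (by simp)
      rcases max_choice (rateSum r (rowFun b)) (maxRows r (c :: l)) with h' | h'
      · exact ⟨b, by simp, h'⟩
      · exact ⟨a, by simp [List.mem_cons.1 ha], h'.trans h⟩

theorem gateTable_eq_maxRows (r : Rates) (m : Procedure) (g : Gate) :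
    gateTable r m g = maxRows r (tableRows m g) := by
  cases m <;> cases g <;>
    simp only [gateTable, tableRows, maxRows]
  all_goals repeat' refine congrArg₂ max ?_ ?_
  all_goals
    simp [rateSum, rateVars, rowFun, RateVar.val, RateVar.index, RateVar.index.rank]
    ring

/-- All first-order expressions of a procedure. -/
def allRows (m : Procedure) : List (List ℕ) :=
  tableRows m .idle ++ tableRows m .had ++ tableRows m .cx ++ tableRows m .pt

theorem rateSum_le_tableMax (r : Rates) (m : Procedure) {a : List ℕ} (ha : a ∈ allRows m) :
    rateSum r (rowFun a) ≤ tableMax r m := by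
  unfold tableMax
  simp only [allRows, List.mem_append] at ha
  rcases ha with ((h | h) | h) | h
  · exact (rateSum_le_maxRows r h).trans ((gateTable_eq_maxRows r m _).ge.trans
      ((le_max_left _ _).trans (le_max_left _ _)))
  · exact (rateSum_le_maxRows r h).trans ((gateTable_eq_maxRows r m _).ge.trans
      ((le_max_right _ _).trans (le_max_left _ _)))
  · exact (rateSum_le_maxRows r h).trans ((gateTable_eq_maxRows r m _).ge.trans
      ((le_max_left _ _).trans (le_max_right _ _)))
  · exact (rateSum_le_maxRows r h).trans ((gateTable_eq_maxRows r m _).ge.trans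
      ((le_max_right _ _).trans (le_max_right _ _)))

/-! ### The maximal error probabilities of the encoded gates -/

/-- The circuit in which an encoded gate is analyzed. -/
def gateCircuit (m : Procedure) (g : Gate) : Program := gateLead m g ++ gateBody m g

/-- The test for a flip at a measurement of the body of a gate. -/
def gateTest (m : Procedure) (g : Gate) (L : ℕ) (s : State) : Bool :=
  s.errorAt (measCount (gateLead m g) + L)

theorem length_gateCircuit (m : Procedure) (g : Gate) : (gateCircuit m g).length ≤ 65 := by
  cases m <;> cases g <;> decide +kernel

theorem measCount_gateBody_pos (m : Procedure) (g : Gate) : 0 < measCount (gateBody m g) := by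
  cases m <;> cases g <;> decide +kernel

theorem gateTest_ideal (m : Procedure) (g : Gate) :
    ∀ L < measCount (gateBody m g), gateTest m g L (ideal (gateCircuit m g) State.clean) = false := by
  cases m <;> cases g <;> decide +kernel

/-- The first-order coefficients of every measurement of a gate are dominated by an expression of
the table. -/
theorem gate_coef_le (m : Procedure) (g : Gate) :
    ∀ L < measCount (gateBody m g), ∃ a ∈ tableRows m g, ∀ v ∈ rateVars,
      coef (gateCircuit m g) (gateTest m g L) State.clean v ≤ rowFun a v := by
  cases m <;> cases g <;> decide +kernel

/-- Every expression of the table belongs to a measurement of the gate. -/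
theorem exists_gate_coef_eq (m : Procedure) (g : Gate) :
    ∀ a ∈ tableRows m g, ∃ L < measCount (gateBody m g), ∀ v ∈ rateVars,
      coef (gateCircuit m g) (gateTest m g L) State.clean v = rowFun a v := by
  cases m <;> cases g <;> decide +kernel

theorem abs_gateMax_sub_gateTable_le {r : Rates} (hr : r.Valid) (m : Procedure) (g : Gate) :
    |gateMax r m g - gateTable r m g| ≤ 2 * 65 ^ 2 * r.total ^ 2 := by
  set K := measCount (gateBody m g) with hK
  have : Nonempty (Fin K) := ⟨⟨0, measCount_gateBody_pos m g⟩⟩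
  set c : ℝ := 2 * 65 ^ 2 * r.total ^ 2 with hc
  have hstrand : ∀ L < K, |strandError r (gateCircuit m g) (measCount (gateLead m g) + L) -
      rateSum r (coef (gateCircuit m g) (gateTest m g L) State.clean)| ≤ c := by
    intro L hL
    rw [strandError_eq_expect, ← firstOrder_eq_rateSum]
    refine (abs_expect_sub_firstOrder_le hr (gateCircuit m g) (gateTest m g L) State.clean
      (gateTest_ideal m g L hL)).trans ?_
    have : ((gateCircuit m g).length : ℝ) ≤ 65 := by exact_mod_cast length_gateCircuit m g
    rw [hc]
    gcongr
  have hbdd : BddAbove (Set.range fun L : Fin K =>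
      strandError r (gateCircuit m g) (measCount (gateLead m g) + L)) :=
    Set.Finite.bddAbove (Set.finite_range _)
  have hmax : gateMax r m g = ⨆ L : Fin K,
      strandError r (gateCircuit m g) (measCount (gateLead m g) + L) := rfl
  rw [abs_le, gateTable_eq_maxRows]
  constructor
  · have hne : tableRows m g ≠ [] := by cases m <;> cases g <;> simp [tableRows]
    obtain ⟨a, ha, h⟩ := exists_maxRows_eq r hne
    obtain ⟨L, hL, hv⟩ := exists_gate_coef_eq m g a ha
    have h1 := (abs_le.1 (hstrand L hL)).1
    rw [rateSum_congr r hv] at h1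
    have h2 := le_ciSup hbdd ⟨L, hL⟩
    rw [hmax, h]
    linarith
  · rw [hmax, sub_le_iff_le_add]
    refine ciSup_le fun L => ?_
    obtain ⟨a, ha, hv⟩ := gate_coef_le m g L L.2
    have h1 := (abs_le.1 (hstrand L L.2)).2
    have h2 := rateSum_mono hr hv
    have h3 := rateSum_le_maxRows r ha
    linarith

/-! ### The steps of a computation on standard labels -/

/-- The steps of an encoded computation in Steane's method, with the order of error correction that
an idle step finds. -/
inductive StepKind where
  | init | idle (o : Order) | had | cx | pt

/-- The operations of a step, on the blocks `2` and `3`. -/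
def stepCode (m : Procedure) : StepKind → Program
  | .init => [.prep 2 B] ++ correct m 2 .zx
  | .idle o => correct m 2 o.flip
  | .had => [.had 2] ++ correct m 2 .xz
  | .cx => [.cx 2 3] ++ correct m 2 .zx ++ correct m 3 .xz
  | .pt => [.prep 1 B, .cx 1 2, .meas 2, .swap 1 2] ++ correct m 2 .zx

/-- The blocks whose errors matter for a step. -/
def StepKind.ins : StepKind → List ℕ
  | .init => []
  | .cx => [2, 3]
  | _ => [2]

/-- The blocks that are corrected in the end. -/
def StepKind.outs : StepKind → List ℕ
  | .cx => [2, 3]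
  | _ => [2]

/-- The order in which the blocks have to be corrected before the step. -/
def StepKind.inOrder : StepKind → ℕ → Order
  | .init, _ => .zx
  | .idle o, _ => o
  | .had, _ => .zx
  | .cx, b => if b = 3 then .xz else .zx
  | .pt, _ => .xz

/-- The order in which the step corrects the blocks. -/
def StepKind.outOrder : StepKind → ℕ → Order
  | .init, _ => .zx
  | .idle o, _ => o.flip
  | .had, _ => .xz
  | .cx, b => if b = 3 then .xz else .zx
  | .pt, _ => .zx

/-- The error of a block: its bit flip and its phase flip. -/
def State.err (s : State) (b : ℕ) : Bool × Bool := (s.x b, s.z b)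

/-- Errors `v` and `w` on the blocks `2` and `3`. -/
def State.load (v w : Bool × Bool) : State :=
  ⟨fun b => if b = 2 then v.1 else if b = 3 then w.1 else false,
   fun b => if b = 2 then v.2 else if b = 3 then w.2 else false, []⟩

/-- No error. -/
abbrev noErr : Bool × Bool := (false, false)

theorem State.load_noErr : State.load noErr noErr = State.clean := by
  refine State.mk_congr (fun b => ?_) (fun b => ?_) rfl <;> simp

/-- The test whether block `b` has an error `v` with `h v`. -/
def errTest (h : Bool × Bool → Bool) (b : ℕ) (s : State) : Bool := h (s.err b)

/-- The test for an arbitrary error. -/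
def isErr (v : Bool × Bool) : Bool := v.1 || v.2

/-- A function that is additive in the error. -/
def AdditiveFn (h : Bool × Bool → Bool) : Prop :=
  ∀ v w, h (v.1 ^^ w.1, v.2 ^^ w.2) = (h v ^^ h w)

theorem AdditiveFn.noErr {h : Bool × Bool → Bool} (hh : AdditiveFn h) : h noErr = false := by
  have := hh Homogeneous.noErr Homogeneous.noErr
  simpa using this

theorem AdditiveFn.test {h : Bool × Bool → Bool} (hh : AdditiveFn h) (b : ℕ) :
    AdditiveTest (errTest h b) := fun s s' _ => hh (s.err b) (s'.err b)

/-- The coefficients of the first-order probability that error correction in the order `o` leaves an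
error `v` with `h v`. -/
def residual (m : Procedure) (o : Order) (h : Bool × Bool → Bool) : RateVar → ℕ :=
  coef (correct m 2 o) (errTest h 2) State.clean

/-- The three nontrivial errors. -/
def errs : List (Bool × Bool) := [(true, false), (false, true), (true, true)]

theorem coef_errTest {h : Bool × Bool → Bool} (hh : h noErr = false) (p : Program) (b : ℕ)
    (s : State) (v : RateVar) :
    coef p (errTest h b) s v = (errs.map fun u => (h u).toNat * coef p (errTest (· == u) b) s v).sum := by
  have key : ∀ w, (h w).toNat = (errs.map fun u => (h u).toNat * (w == u).toNat).sum := by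
    have h0 : h (false, false) = false := hh
    rintro ⟨_ | _, _ | _⟩ <;> simp only [errs, List.map, h0] <;>
      generalize h (true, false) = a <;> generalize h (false, true) = b <;>
      generalize h (true, true) = c <;> revert a b c <;> decide
  induction p generalizing s with
  | nil => simp [coef, errs]
  | cons i p ih =>
    simp only [coef]
    rw [ih]
    rcases i.faultOf v with _ | φ
    · simp [errs]
    · simp only [Option.elim_some, errTest]
      rw [key]
      simp [errs]
      ring

theorem length_stepCode {m : Procedure} (hm : m ≠ .knill) (K : StepKind) :
    (stepCode m K).length ≤ 33 := by
  rcases m with _ | _ | _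
  · rcases K with _ | (_ | _) | _ | _ | _ <;> decide +kernel
  · rcases K with _ | (_ | _) | _ | _ | _ <;> decide +kernel
  · exact absurd rfl hm

/-- After a step without faults no error is left on the corrected blocks, whatever it was before. -/
theorem err_ideal_stepCode {m : Procedure} (hm : m ≠ .knill) (K : StepKind) :
    ∀ b ∈ K.outs, ∀ v w, (ideal (stepCode m K) (State.load v w)).err b = noErr := by
  rcases m with _ | _ | _
  · rcases K with _ | (_ | _) | _ | _ | _ <;> decide +kernel
  · rcases K with _ | (_ | _) | _ | _ | _ <;> decide +kernel
  · exact absurd rfl hm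

theorem coef_stepCode_indicator {m : Procedure} (hm : m ≠ .knill) (K : StepKind) :
    ∀ b ∈ K.outs, ∀ u ∈ errs, ∀ v ∈ rateVars,
      coef (stepCode m K) (errTest (· == u) b) State.clean v =
        residual m (K.outOrder b) (· == u) v := by
  rcases m with _ | _ | _
  · rcases K with _ | (_ | _) | _ | _ | _ <;> decide +kernel
  · rcases K with _ | (_ | _) | _ | _ | _ <;> decide +kernel
  · exact absurd rfl hm

/-- To first order, the errors left by a step stem from its last error correction. -/
theorem coef_stepCode {m : Procedure} (hm : m ≠ .knill) (K : StepKind) {b : ℕ} (hb : b ∈ K.outs)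
    {h : Bool × Bool → Bool} (hh : h noErr = false) : ∀ v ∈ rateVars,
      coef (stepCode m K) (errTest h b) State.clean v = residual m (K.outOrder b) h v := by
  intro v hv
  rw [residual, coef_errTest hh, coef_errTest hh]
  congr 1
  refine List.map_congr_left fun u hu => ?_
  rw [coef_stepCode_indicator hm K b hb u hu v hv, residual]

/-- No single fault leaves errors on both blocks of a controlled-NOT step. -/
theorem coef_cx_both {m : Procedure} (hm : m ≠ .knill) : ∀ v ∈ rateVars,
    coef (stepCode m .cx) (fun s => errTest isErr 2 s && errTest isErr 3 s) State.clean v = 0 := by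
  rcases m with _ | _ | _
  · decide +kernel
  · decide +kernel
  · exact absurd rfl hm

/-- The result at a measurement of a step without faults, as a function of the initial errors. -/
def resultOf (m : Procedure) (K : StepKind) (j : ℕ) (v w : Bool × Bool) : Bool :=
  (ideal (stepCode m K) (State.load v w)).errorAt j

theorem resultOf_noErr {m : Procedure} (hm : m ≠ .knill) (K : StepKind) :
    ∀ j < measCount (stepCode m K), resultOf m K j noErr noErr = false := by
  rcases m with _ | _ | _
  · rcases K with _ | (_ | _) | _ | _ | _ <;> decide +kernel
  · rcases K with _ | (_ | _) | _ | _ | _ <;> decide +kernel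
  · exact absurd rfl hm

theorem resultOf_add (K : StepKind) :
    ∀ j < measCount (stepCode .singleSteane K), ∀ v w v' w' : Bool × Bool,
      resultOf .singleSteane K j (v.1 ^^ v'.1, v.2 ^^ v'.2) (w.1 ^^ w'.1, w.2 ^^ w'.2) =
        (resultOf .singleSteane K j v w ^^ resultOf .singleSteane K j v' w') := by
  rcases K with _ | (_ | _) | _ | _ | _ <;> decide +kernel

/-- First-order contribution of the errors that a step finds on block `b`. -/
def incoming (m : Procedure) (K : StepKind) (b : ℕ) (h : Bool × Bool → Bool) : RateVar → ℕ :=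
  fun v => if b ∈ K.ins then residual m (K.inOrder b) h v else 0

/-- The first-order coefficients of every measurement of a computation are dominated by an
expression of the table. -/
theorem coef_result_le {m : Procedure} (hm : m ≠ .knill) (K : StepKind) :
    ∀ j < measCount (stepCode m K), ∃ a ∈ allRows m, ∀ v ∈ rateVars,
      coef (stepCode m K) (fun s => s.errorAt j) State.clean v +
        incoming m K 2 (fun u => resultOf m K j u noErr) v +
        incoming m K 3 (fun u => resultOf m K j noErr u) v ≤ rowFun a v := by
  rcases m with _ | _ | _
  · rcases K with _ | (_ | _) | _ | _ | _ <;> decide +kernel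
  · rcases K with _ | (_ | _) | _ | _ | _ <;> decide +kernel
  · exact absurd rfl hm

theorem linear_stepCode (K : StepKind) : ∀ i ∈ stepCode .singleSteane K, i.Linear := by
  rcases K with _ | (_ | _) | _ | _ | _ <;>
  simp [stepCode, correct, corrX, corrZ, coupleX, coupleZ, Order.flip, Instr.Linear,
    additiveRule_lastOne]

theorem localTo_stepCode {m : Procedure} (hm : m ≠ .knill) (K : StepKind) :
    LocalTo K.outs (stepCode m K) K.ins 0 := by
  rcases m with _ | _ | _
  · rcases K with _ | (_ | _) | _ | _ | _ <;>
    simp [stepCode, correct, corrX, corrZ, coupleX, coupleZ, Order.flip, StepKind.ins,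
      StepKind.outs, LocalTo, readsLast_lastOne]
  · rcases K with _ | (_ | _) | _ | _ | _ <;>
    simp [stepCode, correct, corrX, corrZ, coupleX, coupleZ, Order.flip, StepKind.ins,
      StepKind.outs, LocalTo, readsLast_lastBoth]
  · exact absurd rfl hm

/-- The blocks that a step may change. -/
theorem writes_stepCode {m : Procedure} (hm : m ≠ .knill) (K : StepKind) :
    ∀ i ∈ stepCode m K, ∀ b ∈ i.writes, b ∈ 0 :: 1 :: K.outs := by
  rcases m with _ | _ | _
  · rcases K with _ | (_ | _) | _ | _ | _ <;>
    simp [stepCode, correct, corrX, corrZ, coupleX, coupleZ, Order.flip,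
      StepKind.outs, Instr.writes]
  · rcases K with _ | (_ | _) | _ | _ | _ <;>
    simp [stepCode, correct, corrX, corrZ, coupleX, coupleZ, Order.flip,
      StepKind.outs, Instr.writes]
  · exact absurd rfl hm

/-! ### Error probabilities of a single step -/

/-- Second-order terms occur only for double coupling, where updates of the record of known errors
are not additive. -/
def secondOrder (m : Procedure) : ℝ := if m = .doubleSteane then 1 else 0

theorem secondOrder_nonneg (m : Procedure) : 0 ≤ secondOrder m := by
  unfold secondOrder
  split_ifs <;> norm_num

theorem ind_and (a b : Bool) : ind (a && b) = ind a * ind b := by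
  cases a <;> cases b <;> simp [ind]

theorem isErr_eq_false {v : Bool × Bool} (h : isErr v = false) : v = noErr := by
  rcases v with ⟨_ | _, _ | _⟩ <;> simp_all [isErr]

theorem isErr_noErr : isErr noErr = false := rfl

/-- Up to second order, a test that is false in the absence of errors is true only if the initial
errors or a single fault make it true. -/
theorem expect_stepCode_le {r : Rates} (hr : r.Valid) {m : Procedure} (hm : m ≠ .knill)
    (K : StepKind) (v w : Bool × Bool) {g : State → Bool}
    (hg : g (ideal (stepCode m K) State.clean) = false) :
    expect r (stepCode m K) (fun a => ind (g a)) (State.load v w) ≤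
      ind (g (ideal (stepCode m K) (State.load v w))) +
        rateSum r (coef (stepCode m K) g State.clean) +
        (2 * 33 ^ 2 * r.total ^ 2 + 33 * r.total * (ind (isErr v) + ind (isErr w))) := by
  have hS := hr.total_nonneg
  have hlen : ((stepCode m K).length : ℝ) ≤ 33 := by exact_mod_cast length_stepCode hm K
  have hfo := firstOrder_nonneg hr (stepCode m K) g State.clean
  have hG := ind_nonneg (g (ideal (stepCode m K) (State.load v w)))
  have hv := ind_nonneg (isErr v)
  have hw := ind_nonneg (isErr w)
  rw [← firstOrder_eq_rateSum]
  by_cases h : isErr v = false ∧ isErr w = false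
  · rw [isErr_eq_false h.1, isErr_eq_false h.2, State.load_noErr]
    have h1 := (abs_le.1 (abs_expect_sub_firstOrder_le hr (stepCode m K) g State.clean hg)).2
    have h2 : 2 * ((stepCode m K).length : ℝ) ^ 2 * r.total ^ 2 ≤ 2 * 33 ^ 2 * r.total ^ 2 := by
      gcongr
    rw [hg, isErr_noErr, ind_false]
    linarith
  · have h1 := (abs_le.1 (abs_expect_sub_ideal_le hr (stepCode m K) g (State.load v w))).2
    have h2 : ((stepCode m K).length : ℝ) * r.total ≤ 33 * r.total := by gcongr
    have h3 : 1 ≤ ind (isErr v) + ind (isErr w) := by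
      by_cases h' : isErr v = false
      · have : isErr w = true := by simpa [h'] using h
        rw [this, ind_true]
        linarith
      · rw [Bool.not_eq_false] at h'
        rw [h', ind_true]
        linarith
    nlinarith [mul_nonneg hS (sub_nonneg.2 h3), sq_nonneg r.total]

/-- For additive tests, single coupling has no terms of second order. -/
theorem expect_stepCode_le_secondOrder {r : Rates} (hr : r.Valid) {m : Procedure}
    (hm : m ≠ .knill) (K : StepKind) (v w : Bool × Bool) {g : State → Bool}
    (hg : g (ideal (stepCode m K) State.clean) = false)
    (hadd : m = .singleSteane → AdditiveTest g) :
    expect r (stepCode m K) (fun a => ind (g a)) (State.load v w) ≤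
      ind (g (ideal (stepCode m K) (State.load v w))) +
        rateSum r (coef (stepCode m K) g State.clean) + secondOrder m *
        (2 * 33 ^ 2 * r.total ^ 2 + 33 * r.total * (ind (isErr v) + ind (isErr w))) := by
  rcases m with _ | _ | _
  · have := expect_le_firstOrder_of_linear hr (linear_stepCode K) (hadd rfl) (State.load v w)
    have hz : State.zero (State.load v w).out.length = State.clean := rfl
    rw [firstOrder_eq_rateSum, hz] at this
    simpa [secondOrder] using this
  · have := expect_stepCode_le hr hm K v w hg
    simpa [secondOrder] using this
  · exact absurd rfl hm

/-- The error of block `b`, provided that it matters for the step. -/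
def entering (K : StepKind) (σ : ℕ → ℕ) (s : State) (b : ℕ) : Bool × Bool :=
  if b ∈ K.ins then s.err (σ b) else noErr

/-- A step on relabelled blocks acts as on standard labels: only the errors of the blocks that enter
the step matter. -/
theorem expect_rename_stepCode (r : Rates) {m : Procedure} (hm : m ≠ .knill) (K : StepKind)
    {σ : ℕ → ℕ} (hσ : Function.Injective σ) (s : State) {g g' : State → ℝ}
    (hg : ∀ a a', Sim σ K.outs s.out a a' → g a = g' a') :
    expect r (rename σ (stepCode m K)) g s =
      expect r (stepCode m K) g' (State.load (entering K σ s 2) (entering K σ s 3)) := by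
  refine expect_rename r hσ (stepCode m K) (localTo_stepCode hm K) ⟨fun b hb => ?_, fun b hb => ?_,
    rfl⟩ hg
  all_goals cases K <;> simp [StepKind.ins] at hb
  all_goals try (rcases hb with rfl | rfl)
  all_goals simp_all [State.load, entering, StepKind.ins, State.err]

theorem Sim.errTest {σ : ℕ → ℕ} {S : List ℕ} {v : List Bool} {a a' : State} (h : Sim σ S v a a')
    {b : ℕ} (hb : b ∈ S) (f : Bool × Bool → Bool) : f (a.err (σ b)) = errTest f b a' := by
  rw [Homogeneous.errTest, State.err, State.err, h.x b hb, h.z b hb]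

section Step

variable {r : Rates} {m : Procedure} {K : StepKind} {σ : ℕ → ℕ}

theorem errTest_ideal_clean (hm : m ≠ .knill) {b : ℕ} (hb : b ∈ K.outs)
    {h : Bool × Bool → Bool} (hh : h noErr = false) :
    errTest h b (ideal (stepCode m K) State.clean) = false := by
  rw [← State.load_noErr, errTest, err_ideal_stepCode hm K b hb, hh]

theorem expect_isErr_step_le (hr : r.Valid) (hm : m ≠ .knill) (hσ : Function.Injective σ) {b : ℕ}
    (hb : b ∈ K.outs) (s : State) :
    expect r (rename σ (stepCode m K)) (fun a => ind (isErr (a.err (σ b)))) s ≤ 33 * r.total := by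
  rw [expect_rename_stepCode r hm K hσ s (g' := fun a => ind (errTest isErr b a))
    fun a a' H => by rw [H.errTest hb isErr]]
  set s' := State.load (entering K σ s 2) (entering K σ s 3)
  have h1 := (abs_le.1 (abs_expect_sub_ideal_le hr (stepCode m K) (errTest isErr b) s')).2
  have h0 : errTest isErr b (ideal (stepCode m K) s') = false := by
    rw [errTest, err_ideal_stepCode hm K b hb]
    rfl
  rw [h0, ind_false] at h1
  have hlen : ((stepCode m K).length : ℝ) ≤ 33 := by exact_mod_cast length_stepCode hm K
  have := mul_le_mul_of_nonneg_right hlen hr.total_nonneg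
  linarith

theorem expect_err_step_le (hr : r.Valid) (hm : m ≠ .knill) (hσ : Function.Injective σ) {b : ℕ}
    (hb : b ∈ K.outs) {h : Bool × Bool → Bool} (hh : h noErr = false)
    (hadd : m = .singleSteane → AdditiveFn h) (s : State) :
    expect r (rename σ (stepCode m K)) (fun a => ind (h (a.err (σ b)))) s ≤
      rateSum r (residual m (K.outOrder b) h) + secondOrder m * (2 * 33 ^ 2 * r.total ^ 2 +
        33 * r.total * (ind (isErr (entering K σ s 2)) + ind (isErr (entering K σ s 3)))) := by
  rw [expect_rename_stepCode r hm K hσ s (g' := fun a => ind (errTest h b a))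
    fun a a' H => by rw [H.errTest hb h]]
  have h1 := expect_stepCode_le_secondOrder hr hm K (entering K σ s 2) (entering K σ s 3)
    (errTest_ideal_clean hm hb hh) fun hs => (hadd hs).test b
  rwa [rateSum_congr r (coef_stepCode hm K hb hh), errTest, err_ideal_stepCode hm K b hb, hh,
    ind_false, zero_add] at h1

theorem expect_both_step_le (hr : r.Valid) (hm : m ≠ .knill) (hσ : Function.Injective σ)
    (s : State) :
    expect r (rename σ (stepCode m .cx))
        (fun a => ind (isErr (a.err (σ 2))) * ind (isErr (a.err (σ 3)))) s ≤
      2 * 33 ^ 2 * r.total ^ 2 +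
        33 * r.total * (ind (isErr (entering .cx σ s 2)) + ind (isErr (entering .cx σ s 3))) := by
  have h2 : 2 ∈ StepKind.cx.outs := by simp [StepKind.outs]
  have h3 : 3 ∈ StepKind.cx.outs := by simp [StepKind.outs]
  rw [expect_rename_stepCode r hm .cx hσ s
    (g' := fun a => ind (errTest isErr 2 a && errTest isErr 3 a))
    fun a a' H => by rw [H.errTest h2 isErr, H.errTest h3 isErr, ind_and]]
  have h1 := expect_stepCode_le hr hm .cx (entering .cx σ s 2) (entering .cx σ s 3)
    (g := fun a => errTest isErr 2 a && errTest isErr 3 a) (by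
      simp only [errTest_ideal_clean hm h2 isErr_noErr, Bool.false_and])
  have h0 : errTest isErr 2 (ideal (stepCode m .cx)
      (State.load (entering .cx σ s 2) (entering .cx σ s 3))) = false := by
    rw [errTest, err_ideal_stepCode hm .cx 2 h2]
    rfl
  rwa [rateSum_congr r (coef_cx_both hm), rateSum_zero, h0, Bool.false_and, ind_false, zero_add,
    zero_add] at h1

theorem expect_result_step_le (hr : r.Valid) (hm : m ≠ .knill) (hσ : Function.Injective σ)
    {j : ℕ} (hj : j < measCount (stepCode m K)) (s : State) :
    expect r (rename σ (stepCode m K)) (fun a => ind (a.errorAt (s.out.length + j))) s ≤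
      ind (resultOf m K j (entering K σ s 2) (entering K σ s 3)) +
        rateSum r (coef (stepCode m K) (fun a => a.errorAt j) State.clean) +
        secondOrder m * (2 * 33 ^ 2 * r.total ^ 2 +
        33 * r.total * (ind (isErr (entering K σ s 2)) + ind (isErr (entering K σ s 3)))) := by
  rw [expect_rename_stepCode r hm K hσ s (g' := fun a => ind (a.errorAt j))
    fun a a' H => by rw [H.errorAt]]
  refine expect_stepCode_le_secondOrder hr hm K _ _ ?_ fun _ => additiveTest_errorAt j
  have := resultOf_noErr hm K j hj
  rwa [resultOf, State.load_noErr] at this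

theorem ind_resultOf_le (hm : m ≠ .knill) {j : ℕ} (hj : j < measCount (stepCode m K))
    (v w : Bool × Bool) :
    ind (resultOf m K j v w) ≤ ind (resultOf m K j v noErr) + ind (resultOf m K j noErr w) +
      secondOrder m * (ind (isErr v) * ind (isErr w)) := by
  rcases m with _ | _ | _
  · have := resultOf_add K j hj v noErr noErr w
    simp only [Bool.xor_false, Bool.false_xor] at this
    rw [this]
    have := ind_xor_le (resultOf .singleSteane K j v noErr) (resultOf .singleSteane K j noErr w)
    simpa [secondOrder] using this
  · have h1 := ind_nonneg (resultOf .doubleSteane K j v noErr)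
    have h2 := ind_nonneg (resultOf .doubleSteane K j noErr w)
    have h3 := ind_le_one (resultOf .doubleSteane K j v w)
    simp only [secondOrder, if_true, one_mul]
    rcases hv : isErr v with _ | _
    · rw [isErr_eq_false hv, ind_false, zero_mul]
      have := ind_nonneg (resultOf .doubleSteane K j noErr noErr)
      linarith
    · rcases hw : isErr w with _ | _
      · rw [isErr_eq_false hw, ind_false, mul_zero]
        have := ind_nonneg (resultOf .doubleSteane K j noErr noErr)
        linarith
      · rw [ind_true]
        linarith
  · exact absurd rfl hm

end Step

/-! ### Invariants of encoded computations -/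

/-- What is known about the unknown errors of the qubits in use, after the program `p`: they are
rare; errors on two of them at once are of second order; and their distribution is, to first order,
the one that the most recent error correction produces by itself. -/
structure Inv (r : Rates) (m : Procedure) (p : Program) (o : Orders) : Prop where
  small : ∀ q a, o q = some a →
    expect r p (fun s => ind (isErr (s.err (q + 2)))) State.clean ≤ 33 * r.total
  pair : ∀ q q' a a', q ≠ q' → o q = some a → o q' = some a' →
    expect r p (fun s => ind (isErr (s.err (q + 2))) * ind (isErr (s.err (q' + 2)))) State.clean ≤
      4 * 33 ^ 2 * r.total ^ 2
  first : ∀ q a, o q = some a → ∀ h : Bool × Bool → Bool, h noErr = false →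
    (m = .singleSteane → AdditiveFn h) →
    expect r p (fun s => ind (h (s.err (q + 2)))) State.clean ≤
      rateSum r (residual m a h) + secondOrder m * (4 * 33 ^ 2 * r.total ^ 2)

/-- A step of kind `K`, on blocks relabelled by `σ`, finds its qubits in the orders that it needs
and changes the orders `o` to `o'`. -/
structure StepFits (m : Procedure) (K : StepKind) (σ : ℕ → ℕ) (o o' : Orders) : Prop where
  inj : Function.Injective σ
  ins : ∀ b ∈ K.ins, ∃ q, σ b = q + 2 ∧ o q = some (K.inOrder b)
  outs : ∀ q, (∃ b ∈ K.outs, σ b = q + 2 ∧ o' q = some (K.outOrder b)) ∨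
    (o' q = o q ∧ ∀ i ∈ rename σ (stepCode m K), q + 2 ∉ i.writes)

section Computation

variable {r : Rates} {m : Procedure} {K : StepKind} {σ : ℕ → ℕ} {p : Program} {o o' : Orders}

theorem Inv.expect_entering_le (hr : r.Valid) (hI : Inv r m p o) (hf : StepFits m K σ o o') (b : ℕ) :
    expect r p (fun s => ind (isErr (entering K σ s b))) State.clean ≤ 33 * r.total := by
  by_cases hb : b ∈ K.ins
  · obtain ⟨q, hq, ho⟩ := hf.ins b hb
    simpa only [entering, if_pos hb, hq] using hI.small q _ ho
  · have := hr.total_nonneg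
    simp only [entering, if_neg hb, isErr_noErr, ind_false, expect_const]
    positivity

theorem Inv.expect_entering_pair_le (hr : r.Valid) (hI : Inv r m p o)
    (hf : StepFits m K σ o o') :
    expect r p (fun s => ind (isErr (entering K σ s 2)) * ind (isErr (entering K σ s 3)))
      State.clean ≤ 4 * 33 ^ 2 * r.total ^ 2 := by
  have hS := hr.total_nonneg
  by_cases h2 : 2 ∈ K.ins
  · by_cases h3 : 3 ∈ K.ins
    · obtain ⟨q, hq, ho⟩ := hf.ins 2 h2
      obtain ⟨q', hq', ho'⟩ := hf.ins 3 h3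
      have hne : q ≠ q' := by
        rintro rfl
        exact absurd (hf.inj (hq.trans hq'.symm)) (by norm_num)
      simpa only [entering, if_pos h2, if_pos h3, hq, hq'] using hI.pair q q' _ _ hne ho ho'
    · simp only [entering, if_neg h3, isErr_noErr, ind_false, mul_zero, expect_const]
      positivity
  · simp only [entering, if_neg h2, isErr_noErr, ind_false, zero_mul, expect_const]
    positivity

theorem Inv.expect_entering_test_le (hI : Inv r m p o) (hf : StepFits m K σ o o')
    (hr : r.Valid) (b : ℕ) {h : Bool × Bool → Bool} (hh : h noErr = false)
    (hadd : m = .singleSteane → AdditiveFn h) :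
    expect r p (fun s => ind (h (entering K σ s b))) State.clean ≤
      rateSum r (incoming m K b h) + secondOrder m * (4 * 33 ^ 2 * r.total ^ 2) := by
  have hS := hr.total_nonneg
  have hm := secondOrder_nonneg m
  by_cases hb : b ∈ K.ins
  · obtain ⟨q, hq, ho⟩ := hf.ins b hb
    have hinc : incoming m K b h = residual m (K.inOrder b) h := by
      funext v
      exact if_pos hb
    rw [hinc]
    simpa only [entering, if_pos hb, hq] using hI.first q _ ho h hh hadd
  · have hinc : incoming m K b h = fun _ => 0 := by
      funext v
      exact if_neg hb
    simp only [entering, if_neg hb, hh, ind_false, expect_const, hinc, rateSum_zero]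
    positivity

/-- Averaging the second-order terms of a step over the errors that enter it. -/
theorem Inv.expect_secondOrder_le (hr : r.Valid) (hI : Inv r m p o) (hf : StepFits m K σ o o')
    {c d : ℝ} (hd : 0 ≤ d) :
    expect r p (fun s => c + d * (2 * 33 ^ 2 * r.total ^ 2 + 33 * r.total *
      (ind (isErr (entering K σ s 2)) + ind (isErr (entering K σ s 3))))) State.clean ≤
      c + d * (4 * 33 ^ 2 * r.total ^ 2) := by
  have hS := hr.total_nonneg
  simp only [expect_add, expect_const, expect_const_mul]
  have h2 := hI.expect_entering_le hr hf 2
  have h3 := hI.expect_entering_le hr hf 3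
  have : 33 * r.total * (expect r p (fun s => ind (isErr (entering K σ s 2))) State.clean +
      expect r p (fun s => ind (isErr (entering K σ s 3))) State.clean) ≤
      33 * r.total * (33 * r.total + 33 * r.total) := by gcongr
  have h4 := mul_le_mul_of_nonneg_left (add_le_add_right this (2 * 33 ^ 2 * r.total ^ 2)) hd
  refine (add_le_add_right h4 c).trans (le_of_eq ?_)
  ring

theorem expect_untouched_mul (r : Rates) (p : Program) {b : ℕ} (hb : ∀ i ∈ p, b ∉ i.writes)
    (f : Bool × Bool → ℝ) (g : State → ℝ) (s : State) :
    expect r p (fun a => f (a.err b) * g a) s = f (s.err b) * expect r p g s := by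
  rw [← expect_const_mul]
  exact expect_of_untouched r p hb (fun x z a => f (x, z) * g a) s

theorem expect_untouched (r : Rates) (p : Program) {b : ℕ} (hb : ∀ i ∈ p, b ∉ i.writes)
    (f : Bool × Bool → ℝ) (s : State) : expect r p (fun a => f (a.err b)) s = f (s.err b) := by
  have := expect_untouched_mul r p hb f (fun _ => 1) s
  simpa [expect_const] using this

/-- The step preserves the invariant. -/
theorem Inv.step (hr : r.Valid) (hm : m ≠ .knill) (hI : Inv r m p o) (hf : StepFits m K σ o o') :
    Inv r m (p ++ rename σ (stepCode m K)) o' := by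
  have hS := hr.total_nonneg
  -- a corrected qubit together with a qubit on which the step does not act
  have mixed : ∀ q q' b a', b ∈ K.outs → σ b = q + 2 → o q' = some a' →
      (∀ i ∈ rename σ (stepCode m K), q' + 2 ∉ i.writes) →
      expect r p (expect r (rename σ (stepCode m K)) fun s =>
        ind (isErr (s.err (q' + 2))) * ind (isErr (s.err (q + 2)))) State.clean ≤
      4 * 33 ^ 2 * r.total ^ 2 := by
    intro q q' b a' hb hq ho' hw
    have h1 : ∀ s, expect r (rename σ (stepCode m K)) (fun s =>
        ind (isErr (s.err (q' + 2))) * ind (isErr (s.err (q + 2)))) s ≤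
        33 * r.total * ind (isErr (s.err (q' + 2))) := by
      intro s
      rw [expect_untouched_mul r _ hw (fun v => ind (isErr v)), mul_comm, ← hq]
      exact mul_le_mul_of_nonneg_right (expect_isErr_step_le hr hm hf.inj hb s) (ind_nonneg _)
    refine (expect_mono hr p h1 _).trans ?_
    rw [expect_const_mul]
    have h2 := mul_le_mul_of_nonneg_left (hI.small q' a' ho') (by positivity : 0 ≤ 33 * r.total)
    nlinarith [sq_nonneg r.total]
  refine ⟨fun q a ha => ?_, fun q q' a a' hne ha ha' => ?_, fun q a ha h hh hadd => ?_⟩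
  · rw [expect_append]
    rcases hf.outs q with ⟨b, hb, hq, ho⟩ | ⟨ho, hw⟩
    · rw [← hq]
      exact (expect_mono hr p (expect_isErr_step_le hr hm hf.inj hb) _).trans_eq
        (expect_const _ _ _ _)
    · rw [funext (expect_untouched r _ hw fun v => ind (isErr v))]
      exact hI.small q a (ho ▸ ha)
  · rw [expect_append]
    rcases hf.outs q with ⟨b, hb, hq, ho⟩ | ⟨ho, hw⟩ <;>
      rcases hf.outs q' with ⟨b', hb', hq', ho'⟩ | ⟨ho', hw'⟩
    · have hbb : b ≠ b' := by
        rintro rfl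
        exact hne (Nat.add_right_cancel (hq.symm.trans hq'))
      have hK : K = .cx ∧ ((b = 2 ∧ b' = 3) ∨ (b = 3 ∧ b' = 2)) := by
        cases K <;> simp only [StepKind.outs, List.mem_cons, List.not_mem_nil, or_false] at hb hb'
        case cx => exact ⟨rfl, by omega⟩
        all_goals exact absurd (hb.trans hb'.symm) hbb
      obtain ⟨rfl, hcase⟩ := hK
      have main := (expect_mono hr p (fun s => (expect_both_step_le hr hm hf.inj s).trans_eq
        (by rw [zero_add, one_mul])) State.clean).trans
        (hI.expect_secondOrder_le hr hf (c := 0) zero_le_one)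
      rw [zero_add, one_mul] at main
      rcases hcase with ⟨rfl, rfl⟩ | ⟨rfl, rfl⟩
      · rwa [hq, hq'] at main
      · rw [hq, hq'] at main
        simpa only [mul_comm] using main
    · have := mixed q q' b a' hb hq (ho' ▸ ha') hw'
      simpa only [mul_comm] using this
    · exact mixed q' q b' a hb' hq' (ho ▸ ha) hw
    · have h1 : ∀ s, expect r (rename σ (stepCode m K)) (fun s =>
          ind (isErr (s.err (q + 2))) * ind (isErr (s.err (q' + 2)))) s =
          ind (isErr (s.err (q + 2))) * ind (isErr (s.err (q' + 2))) := by
        intro s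
        rw [expect_untouched_mul r _ hw (fun v => ind (isErr v)),
          expect_untouched r _ hw' fun v => ind (isErr v)]
      rw [funext h1]
      exact hI.pair q q' a a' hne (ho ▸ ha) (ho' ▸ ha')
  · rw [expect_append]
    rcases hf.outs q with ⟨b, hb, hq, ho⟩ | ⟨ho, hw⟩
    · rw [← hq]
      have hab : a = K.outOrder b := by
        rw [ha] at ho
        exact Option.some.inj ho
      rw [hab]
      exact (expect_mono hr p (expect_err_step_le hr hm hf.inj hb hh hadd) _).trans
        (hI.expect_secondOrder_le hr hf (secondOrder_nonneg m))
    · rw [funext (expect_untouched r _ hw fun v => ind (h v))]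
      exact hI.first q a (ho ▸ ha) h hh hadd

/-- The error probability at a measurement of a step. -/
theorem Inv.expect_result_le (hr : r.Valid) (hm : m ≠ .knill) (hI : Inv r m p o)
    (hf : StepFits m K σ o o') {j : ℕ} (hj : j < measCount (stepCode m K)) :
    expect r (p ++ rename σ (stepCode m K)) (fun a => ind (a.errorAt (measCount p + j)))
      State.clean ≤ tableMax r m + 16 * 33 ^ 2 * secondOrder m * r.total ^ 2 := by
  set f : RateVar → ℕ := coef (stepCode m K) (fun a => a.errorAt j) State.clean with hf_def
  have hadd2 : m = .singleSteane → AdditiveFn fun u => resultOf m K j u noErr := by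
    rintro rfl v w
    simpa using resultOf_add K j hj v noErr w noErr
  have hadd3 : m = .singleSteane → AdditiveFn fun u => resultOf m K j noErr u := by
    rintro rfl v w
    simpa using resultOf_add K j hj noErr v noErr w
  have h0 := resultOf_noErr hm K j hj
  have e2 := hI.expect_entering_test_le hf hr 2 (h := fun u => resultOf m K j u noErr) h0 hadd2
  have e3 := hI.expect_entering_test_le hf hr 3 (h := fun u => resultOf m K j noErr u) h0 hadd3
  have e23 := mul_le_mul_of_nonneg_left (hI.expect_entering_pair_le hr hf) (secondOrder_nonneg m)
  have es := hI.expect_secondOrder_le hr hf (c := rateSum r f) (secondOrder_nonneg m)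
  obtain ⟨a, ha, hle⟩ := coef_result_le hm K j hj
  have htab := (rateSum_mono hr hle).trans (rateSum_le_tableMax r m ha)
  rw [rateSum_add, rateSum_add] at htab
  rw [expect_append]
  have hstep : expect r p (expect r (rename σ (stepCode m K))
      fun a => ind (a.errorAt (measCount p + j))) State.clean ≤
      expect r p (fun s => (ind (resultOf m K j (entering K σ s 2) noErr) +
        ind (resultOf m K j noErr (entering K σ s 3)) +
        secondOrder m * (ind (isErr (entering K σ s 2)) * ind (isErr (entering K σ s 3)))) +
        (rateSum r f + secondOrder m * (2 * 33 ^ 2 * r.total ^ 2 + 33 * r.total *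
          (ind (isErr (entering K σ s 2)) + ind (isErr (entering K σ s 3)))))) State.clean := by
    refine expect_mono_of_length hr p _ fun s hs => ?_
    have hs' : measCount p = s.out.length := by
      rw [hs]
      simp [State.clean]
    rw [hs']
    have h1 := expect_result_step_le hr hm hf.inj hj s
    have h2 := ind_resultOf_le hm hj (entering K σ s 2) (entering K σ s 3)
    linarith
  refine hstep.trans ?_
  rw [expect_add r p _ (fun s => rateSum r f + _), expect_add r p _ (fun s => secondOrder m * _),
    expect_add r p (fun s => ind (resultOf m K j (entering K σ s 2) noErr)), expect_const_mul]
  linarith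

end Computation

/-! ### Bounds for encoded computations -/

/-- Labels for two qubits; the ancilla blocks `0` and `1` stay. -/
theorem exists_relabelling {c t : ℕ} (h : c ≠ t) :
    ∃ σ : ℕ → ℕ, Function.Injective σ ∧ σ 0 = 0 ∧ σ 1 = 1 ∧ σ 2 = c + 2 ∧ σ 3 = t + 2 := by
  obtain ⟨e, h0, h1⟩ : ∃ e : Equiv.Perm ℕ, e 0 = c ∧ e 1 = t := by
    refine ⟨(Equiv.swap 0 c).trans (Equiv.swap (Equiv.swap 0 c 1) t), ?_, ?_⟩
    · have : c ≠ Equiv.swap 0 c 1 := by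
        intro hc
        have := (Equiv.swap 0 c).injective ((Equiv.swap_apply_left 0 c).trans hc)
        norm_num at this
      simp [Equiv.swap_apply_of_ne_of_ne this h]
    · simp
  refine ⟨fun n => match n with
    | 0 => 0
    | 1 => 1
    | n + 2 => e n + 2, ?_, rfl, rfl, by simp [h0], by simp [h1]⟩
  intro a b hab
  match a, b with
  | 0, 0 | 1, 1 => rfl
  | a + 2, b + 2 => simpa using hab
  | 0, 1 | 1, 0 => simp at hab
  | 0, b + 2 | 1, b + 2 | a + 2, 0 | a + 2, 1 => simp at hab

theorem Instr.writes_rename (σ : ℕ → ℕ) (i : Instr) : (i.rename σ).writes = i.writes.map σ := by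
  cases i <;> rfl

theorem StepFits.of_outs {m : Procedure} (hm : m ≠ .knill) {K : StepKind} {σ : ℕ → ℕ}
    {o o' : Orders} (inj : Function.Injective σ) (h0 : σ 0 = 0) (h1 : σ 1 = 1)
    (ins : ∀ b ∈ K.ins, ∃ q, σ b = q + 2 ∧ o q = some (K.inOrder b))
    (outs : ∀ b ∈ K.outs, ∃ q, σ b = q + 2 ∧ o' q = some (K.outOrder b))
    (rest : ∀ q, (∀ b ∈ K.outs, σ b ≠ q + 2) → o' q = o q) : StepFits m K σ o o' := by
  refine ⟨inj, ins, fun q => ?_⟩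
  by_cases hq : ∃ b ∈ K.outs, σ b = q + 2
  · obtain ⟨b, hb, hbq⟩ := hq
    obtain ⟨q', hq', ho⟩ := outs b hb
    have : q' = q := by omega
    exact Or.inl ⟨b, hb, hbq, this ▸ ho⟩
  · push Not at hq
    refine Or.inr ⟨rest q hq, fun i hi => ?_⟩
    obtain ⟨i, hi', rfl⟩ := List.mem_map.1 hi
    rw [Instr.writes_rename, List.mem_map]
    rintro ⟨b, hb, hbq⟩
    rcases List.mem_cons.1 (writes_stepCode hm K i hi' b hb) with rfl | hb
    · omega
    · rcases List.mem_cons.1 hb with rfl | hb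
      · omega
      · exact hq b hb hbq

/-- Every admissible step of a computation is one of the standard steps, relabelled. -/
theorem exists_stepFits {m : Procedure} (hm : m ≠ .knill) {o : Orders} {a : Op}
    (ha : a.Admissible m o) :
    ∃ K σ, StepFits m K σ o (a.next o) ∧ a.code m o = rename σ (stepCode m K) := by
  have hcode : ∀ {x y : Program}, (m = .singleSteane → x = y) → (m = .doubleSteane → x = y) →
      x = y := by
    intro x y h1 h2
    rcases m with _ | _ | _
    · exact h1 rfl
    · exact h2 rfl
    · exact absurd rfl hm
  cases a with
  | init q =>
    obtain ⟨σ, inj, h0, h1, h2, -⟩ := exists_relabelling (Nat.succ_ne_self q).symm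
    refine ⟨.init, σ, StepFits.of_outs hm inj h0 h1 ?_ ?_ ?_, hcode ?_ ?_⟩
    · simp [StepKind.ins]
    · simp [StepKind.outs, StepKind.outOrder, Op.next, h2]
    · intro q' hq'
      have : q' ≠ q := by simpa [StepKind.outs, h2, eq_comm] using hq'
      simp [Op.next, this]
    all_goals
      rintro rfl
      simp [Op.code, stepCode, correct, corrX, corrZ, coupleX, coupleZ, rename, Instr.rename, h0, h2]
  | idle q =>
    obtain ⟨σ, inj, h0, h1, h2, -⟩ := exists_relabelling (Nat.succ_ne_self q).symm
    obtain ⟨b, hb⟩ := Option.ne_none_iff_exists'.1 (ha.resolve_left hm)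
    refine ⟨.idle b, σ, StepFits.of_outs hm inj h0 h1 ?_ ?_ ?_, hcode ?_ ?_⟩
    · simp [StepKind.ins, StepKind.inOrder, hb, h2]
    · simp [StepKind.outs, StepKind.outOrder, Op.next, h2, hb]
    · intro q' hq'
      have : q' ≠ q := by simpa [StepKind.outs, h2, eq_comm] using hq'
      simp [Op.next, this]
    all_goals
      rintro rfl
      cases b <;> simp [Op.code, stepCode, correct, corrX, corrZ, coupleX, coupleZ, rename,
        Instr.rename, Order.flip, hb, h0, h2]
  | had q =>
    obtain ⟨σ, inj, h0, h1, h2, -⟩ := exists_relabelling (Nat.succ_ne_self q).symm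
    have hb := ha.resolve_left hm
    refine ⟨.had, σ, StepFits.of_outs hm inj h0 h1 ?_ ?_ ?_, hcode ?_ ?_⟩
    · simp [StepKind.ins, StepKind.inOrder, hb, h2]
    · simp [StepKind.outs, StepKind.outOrder, Op.next, h2]
    · intro q' hq'
      have : q' ≠ q := by simpa [StepKind.outs, h2, eq_comm] using hq'
      simp [Op.next, this]
    all_goals
      rintro rfl
      simp [Op.code, stepCode, correct, corrX, corrZ, coupleX, coupleZ, rename, Instr.rename, h0, h2]
  | cx c t =>
    obtain ⟨σ, inj, h0, h1, h2, h3⟩ := exists_relabelling ha.1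
    have hb := ha.2.resolve_left hm
    refine ⟨.cx, σ, StepFits.of_outs hm inj h0 h1 ?_ ?_ ?_, hcode ?_ ?_⟩
    · simp [StepKind.ins, StepKind.inOrder, hb.1, hb.2, h2, h3]
    · simp [StepKind.outs, StepKind.outOrder, Op.next, hb.1, hb.2, h2, h3]
    · exact fun _ _ => rfl
    all_goals
      rintro rfl
      simp [Op.code, stepCode, correct, corrX, corrZ, coupleX, coupleZ, rename, Instr.rename, h0,
        h2, h3]
  | pt q =>
    obtain ⟨σ, inj, h0, h1, h2, -⟩ := exists_relabelling (Nat.succ_ne_self q).symm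
    have hb := ha.resolve_left hm
    refine ⟨.pt, σ, StepFits.of_outs hm inj h0 h1 ?_ ?_ ?_, hcode ?_ ?_⟩
    · simp [StepKind.ins, StepKind.inOrder, hb, h2]
    · simp [StepKind.outs, StepKind.outOrder, Op.next, h2]
    · intro q' hq'
      have : q' ≠ q := by simpa [StepKind.outs, h2, eq_comm] using hq'
      simp [Op.next, this]
    all_goals
      rintro rfl
      simp [Op.code, stepCode, correct, corrX, corrZ, coupleX, coupleZ, rename, Instr.rename, h0,
        h1, h2]

/-- Induction over the steps of a computation, with an invariant `P`. -/
theorem expect_codeFrom_le {r : Rates} {m : Procedure} {c : ℝ} (P : Program → Orders → Prop)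
    (hstep : ∀ (p : Program) (o : Orders) (a : Op), P p o → a.Admissible m o → P (p ++ a.code m o) (a.next o))
    (hmeas : ∀ (p : Program) (o : Orders) (a : Op), P p o → a.Admissible m o → ∀ j < measCount (a.code m o),
      expect r (p ++ a.code m o) (fun s => ind (s.errorAt (measCount p + j))) State.clean ≤ c)
    (hr : r.Valid) (l : List Op) (p : Program) (o : Orders) (hP : P p o) (hl : AdmissibleFrom m o l)
    {L : ℕ} (h1 : measCount p ≤ L) (h2 : L < measCount (p ++ codeFrom m o l)) :
    expect r (p ++ codeFrom m o l) (fun s => ind (s.errorAt L)) State.clean ≤ c := by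
  induction l generalizing p o with
  | nil =>
    simp only [codeFrom, List.append_nil] at h2
    omega
  | cons a l ih =>
    rw [codeFrom, ← List.append_assoc] at h2 ⊢
    by_cases hL : L < measCount (p ++ a.code m o)
    · rw [expect_append]
      have h3 : expect r (p ++ a.code m o) (expect r (codeFrom m (a.next o) l)
          fun s => ind (s.errorAt L)) State.clean ≤
          expect r (p ++ a.code m o) (fun s => ind (s.errorAt L)) State.clean := by
        refine expect_mono_of_length hr _ _ fun s hs => ?_
        rw [expect_errorAt_of_lt r _ s (by rw [hs]; omega)]
      obtain ⟨j, rfl⟩ := Nat.exists_eq_add_of_le h1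
      refine h3.trans (hmeas p o a hP hl.1 j ?_)
      rw [measCount_append] at hL
      omega
    · exact ih _ _ (hstep p o a hP hl.1) hl.2 (not_lt.1 hL) h2

theorem mem_allRows {m : Procedure} {g : Gate} {a : List ℕ} (ha : a ∈ tableRows m g) :
    a ∈ allRows m := by
  cases g <;> simp [allRows, ha]

/-- In Knill's method every step starts from fresh ancillae, and error propagation is linear. -/
theorem expect_knillGate_le {r : Rates} (hr : r.Valid) (g : Gate) {σ : ℕ → ℕ}
    (hσ : Function.Injective σ) {j : ℕ} (hj : j < measCount (knillGate 2 3 g)) (s : State) :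
    expect r (rename σ (knillGate 2 3 g)) (fun a => ind (a.errorAt (s.out.length + j))) s ≤
      tableMax r .knill := by
  have hloc : LocalTo [] (knillGate 2 3 g) [] 0 := by
    cases g <;> simp [knillGate, teleA, teleB, LocalTo]
  have hlin : ∀ i ∈ knillGate 2 3 g, i.Linear := by
    cases g <;> simp [knillGate, teleA, teleB, Instr.Linear]
  rw [expect_rename r hσ (knillGate 2 3 g) (s' := State.clean) (g' := fun a => ind (a.errorAt j))
    hloc ⟨by simp, by simp, rfl⟩ fun a a' H => by rw [H.errorAt]]
  have h1 := expect_le_firstOrder_of_linear hr hlin (additiveTest_errorAt j) State.clean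
  have h2 : (ideal (knillGate 2 3 g) State.clean).errorAt j = false := by
    have := gateTest_ideal .knill g j hj
    simpa [gateTest, gateCircuit, gateLead, gateBody, measCount] using this
  obtain ⟨a, ha, hle⟩ := gate_coef_le .knill g j hj
  have h3 := (rateSum_mono hr hle).trans (rateSum_le_tableMax r .knill (mem_allRows ha))
  have h4 : gateTest .knill g j = fun s => s.errorAt j := by
    funext s
    simp [gateTest, gateLead, measCount]
  have h5 : gateCircuit .knill g = knillGate 2 3 g := by
    cases g <;> rfl
  rw [h4, h5, ← firstOrder_eq_rateSum] at h3
  rw [h2, ind_false, zero_add] at h1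
  exact h1.trans h3

theorem exists_knillGate_eq {o : Orders} {a : Op} (ha : a.Admissible .knill o)
    (h : 0 < measCount (a.code .knill o)) :
    ∃ g σ, Function.Injective σ ∧ a.code .knill o = rename σ (knillGate 2 3 g) := by
  cases a with
  | init q => simp [Op.code, measCount] at h
  | cx c t =>
    obtain ⟨σ, inj, h0, h1, h2, h3⟩ := exists_relabelling ha.1
    exact ⟨.cx, σ, inj, by
      simp [Op.code, knillGate, teleA, teleB, rename, Instr.rename, h0, h2, h3]⟩
  | idle q =>
    obtain ⟨σ, inj, h0, h1, h2, -⟩ := exists_relabelling (Nat.succ_ne_self q).symm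
    exact ⟨.idle, σ, inj, by
      simp [Op.code, knillGate, teleA, rename, Instr.rename, h0, h2]⟩
  | had q =>
    obtain ⟨σ, inj, h0, h1, h2, -⟩ := exists_relabelling (Nat.succ_ne_self q).symm
    exact ⟨.had, σ, inj, by
      simp [Op.code, knillGate, teleB, rename, Instr.rename, h0, h2]⟩
  | pt q =>
    obtain ⟨σ, inj, h0, h1, h2, -⟩ := exists_relabelling (Nat.succ_ne_self q).symm
    exact ⟨.pt, σ, inj, by
      simp [Op.code, knillGate, teleA, rename, Instr.rename, h0, h2]⟩

/-- The error probability at every measurement of every encoded computation. -/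
theorem strandError_compile_le {r : Rates} (hr : r.Valid) (m : Procedure) {l : List Op}
    (hl : Admissible m l) {L : ℕ} (hL : L < measCount (compile m l)) :
    strandError r (compile m l) L ≤ tableMax r m + 16 * 33 ^ 2 * secondOrder m * r.total ^ 2 := by
  rw [strandError_eq_expect]
  by_cases hm : m = .knill
  · subst hm
    refine expect_codeFrom_le (fun _ _ => True) (fun _ _ _ _ _ => trivial) (fun p o a _ ha j hj => ?_)
      hr l [] _ trivial hl (Nat.zero_le _) hL
    obtain ⟨g, σ, hσ, hcode⟩ := exists_knillGate_eq ha (by omega)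
    rw [hcode] at hj ⊢
    rw [measCount_rename] at hj
    rw [expect_append]
    have h1 : expect r p (expect r (rename σ (knillGate 2 3 g))
        fun s => ind (s.errorAt (measCount p + j))) State.clean ≤
        expect r p (fun _ => tableMax r .knill) State.clean := by
      refine expect_mono_of_length hr p _ fun s hs => ?_
      have hs' : measCount p = s.out.length := by
        rw [hs]
        simp [State.clean]
      rw [hs']
      exact expect_knillGate_le hr g hσ hj s
    rw [expect_const] at h1
    simpa [secondOrder] using h1
  · refine expect_codeFrom_le (Inv r m) (fun p o a hI ha => ?_) (fun p o a hI ha j hj => ?_)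
      hr l [] _ ⟨?_, ?_, ?_⟩ hl (Nat.zero_le _) hL
    · obtain ⟨K, σ, hf, hcode⟩ := exists_stepFits hm ha
      rw [hcode]
      exact hI.step hr hm hf
    · obtain ⟨K, σ, hf, hcode⟩ := exists_stepFits hm ha
      rw [hcode] at hj ⊢
      rw [measCount_rename] at hj
      exact hI.expect_result_le hr hm hf hj
    all_goals simp

theorem computesIndefinitely_of_lt {F : CodeFamily} {τ : ℝ} (hF : F.HasFraction τ) {m : Procedure}
    {r : Rates} (hr : r.Valid)
    (h : tableMax r m + 16 * 33 ^ 2 * secondOrder m * r.total ^ 2 < τ) :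
    ComputesIndefinitely F r m := by
  obtain ⟨c, hc, hev⟩ := hF.exists_anyFailProb_le h
  refine ⟨c, hc, ?_⟩
  filter_upwards [hev] with k hk l hl
  exact hk r hr _ fun L hL => strandError_compile_le hr m hl hL

/-! ### Thresholds of the reduced error models -/

theorem coeff_pos (m : Procedure) (e : Model) : 0 < coeff m e := by
  cases m <;> cases e <;> norm_num [coeff]

theorem abs_coeff_sub_coeffRounded_le (m : Procedure) (e : Model) :
    |coeff m e - coeffRounded m e| ≤ 1 / 200 := by
  cases m <;> cases e <;> norm_num [coeff, coeffRounded, abs_le]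

theorem tableMax_rates_le_iff (m : Procedure) (e : Model) {p τ : ℝ} (hp : 0 ≤ p) :
    tableMax (e.rates p) m ≤ τ ↔ p ≤ coeff m e * τ := by
  cases m <;> cases e <;>
    simp only [tableMax, gateTable, Model.rates, ancRates, coeff, max_le_iff,
      Prod.mk.injEq, reduceCtorEq, and_false, or_false, and_true, or_true, if_true,
      if_false]
  all_goals
    norm_num
    constructor
    · intro h
      linarith
    · intro h
      refine ⟨⟨?_, ?_⟩, ?_, ?_⟩ <;> repeat' apply And.intro
      all_goals linarith

theorem Model.nonneg_of_valid {e : Model} {p : ℝ} (h : (e.rates p).Valid) : 0 ≤ p := by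
  have h1 := h.two_nonneg I X (by simp)
  cases e <;> simp [Model.rates] at h1 <;> linarith

theorem tableMax_rates_lt {m : Procedure} {e : Model} {p τ : ℝ} (hp : 0 ≤ p)
    (h : p < coeff m e * τ) : tableMax (e.rates p) m < τ := by
  have hc := coeff_pos m e
  have h1 : tableMax (e.rates p) m ≤ p / coeff m e :=
    (tableMax_rates_le_iff m e hp).2 (by rw [mul_div_cancel₀ _ hc.ne'])
  exact h1.trans_lt ((div_lt_iff₀' hc).2 h)

end Homogeneous

end

theorem mainTheorem1 :
    -- the probability of an encoded failure is determined by the single-strand error probability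
    (∀ r : Homogeneous.Rates, r.Valid → ∀ (p : Homogeneous.Program) (L n t : ℕ),
      L < Homogeneous.measCount p →
      Homogeneous.failProb r p n t L =
        ∑ i ∈ Finset.Icc (t + 1) n, (n.choose i : ℝ) *
          Homogeneous.strandError r p L ^ i * (1 - Homogeneous.strandError r p L) ^ (n - i)) ∧
    -- in the limit of large blocks it is a step function
    (∀ (F : Homogeneous.CodeFamily) (τ : ℝ), F.HasFraction τ →
      ∀ r : Homogeneous.Rates, r.Valid → ∀ (p : Homogeneous.Program) (L : ℕ),
      L < Homogeneous.measCount p →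
      (Homogeneous.strandError r p L < τ →
        Filter.Tendsto (fun k => Homogeneous.failProb r p (F.len k) (F.t k) L)
          Filter.atTop (nhds 0)) ∧
      (τ < Homogeneous.strandError r p L →
        Filter.Tendsto (fun k => Homogeneous.failProb r p (F.len k) (F.t k) L)
          Filter.atTop (nhds 1) ∧
        Filter.Tendsto (fun k => Homogeneous.anyFailProb r p (F.len k) (F.t k))
          Filter.atTop (nhds 1))) ∧
    -- single-strand error probabilities that stay below `τ` allow procedures of any length
    (∀ (F : Homogeneous.CodeFamily) (τ : ℝ), F.HasFraction τ → ∀ q < τ,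
      ∃ c > 0, ∀ᶠ k in Filter.atTop, ∀ r : Homogeneous.Rates, r.Valid →
        ∀ p : Homogeneous.Program,
        (∀ L < Homogeneous.measCount p, Homogeneous.strandError r p L ≤ q) →
        Homogeneous.anyFailProb r p (F.len k) (F.t k) ≤
          Homogeneous.measCount p * Real.exp (-c * F.len k)) ∧
    -- the maximal single-strand error probability of every encoded gate, to first order
    (∃ A : ℝ, ∀ (m : Homogeneous.Procedure) (g : Homogeneous.Gate) (r : Homogeneous.Rates),
      r.Valid →
      |Homogeneous.gateMax r m g - Homogeneous.gateTable r m g| ≤ A * r.total ^ 2) ∧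
    -- these expressions bound every computation; second-order terms occur only where two
    -- extractions are compared
    (∃ B : Homogeneous.Procedure → ℝ,
      B .singleSteane = 0 ∧ B .knill = 0 ∧ 0 ≤ B .doubleSteane ∧
      (∀ (m : Homogeneous.Procedure) (r : Homogeneous.Rates), r.Valid →
        ∀ l : List Homogeneous.Op, Homogeneous.Admissible m l →
        ∀ L < Homogeneous.measCount (Homogeneous.compile m l),
          Homogeneous.strandError r (Homogeneous.compile m l) L ≤
            Homogeneous.tableMax r m + B m * r.total ^ 2) ∧
      (∀ (F : Homogeneous.CodeFamily) (τ : ℝ), F.HasFraction τ →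
        ∀ (m : Homogeneous.Procedure) (r : Homogeneous.Rates), r.Valid →
        Homogeneous.tableMax r m + B m * r.total ^ 2 < τ →
        Homogeneous.ComputesIndefinitely F r m)) ∧
    -- thresholds of the reduced error models
    (∀ (m : Homogeneous.Procedure) (e : Homogeneous.Model),
      |Homogeneous.coeff m e - Homogeneous.coeffRounded m e| ≤ 1 / 200 ∧
      ∀ p τ : ℝ, 0 ≤ p →
        (Homogeneous.tableMax (e.rates p) m ≤ τ ↔ p ≤ Homogeneous.coeff m e * τ)) ∧
    -- without second-order terms they are rigorous
    (∀ (F : Homogeneous.CodeFamily) (τ : ℝ), F.HasFraction τ →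
      ∀ m : Homogeneous.Procedure, m ≠ .doubleSteane → ∀ (e : Homogeneous.Model) (p : ℝ),
      (e.rates p).Valid → p < Homogeneous.coeff m e * τ →
      Homogeneous.ComputesIndefinitely F (e.rates p) m) := by
  refine ⟨fun r hr p L n t hL => ?_, fun F τ hF r hr p L hL => ⟨fun h => ?_, fun h => ?_⟩,
    fun F τ hF q hq => hF.exists_anyFailProb_le hq, ⟨2 * 65 ^ 2, fun m g r hr => ?_⟩,
    ⟨fun m => 16 * 33 ^ 2 * Homogeneous.secondOrder m, ?_, ?_, ?_, ?_, ?_⟩, fun m e => ⟨?_, ?_⟩, ?_⟩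
  · exact Homogeneous.failProb_eq_binomialTail r p L n t
  · exact hF.tendsto_failProb_zero hr h
  · exact hF.tendsto_failProb_one hr hL h
  · exact Homogeneous.abs_gateMax_sub_gateTable_le hr m g
  · simp [Homogeneous.secondOrder]
  · simp [Homogeneous.secondOrder]
  · have := Homogeneous.secondOrder_nonneg .doubleSteane
    positivity
  · exact fun m r hr l hl L hL => Homogeneous.strandError_compile_le hr m hl hL
  · exact fun F τ hF m r hr h => Homogeneous.computesIndefinitely_of_lt hF hr h
  · exact Homogeneous.abs_coeff_sub_coeffRounded_le m e
  · exact fun p τ hp => Homogeneous.tableMax_rates_le_iff m e hp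
  · intro F τ hF m hm e p hr hp
    refine Homogeneous.computesIndefinitely_of_lt hF hr ?_
    have := Homogeneous.tableMax_rates_lt (Homogeneous.Model.nonneg_of_valid hr) hp
    simpa [Homogeneous.secondOrder, hm] using this
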